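/- Let $n\ge 0$ be an integer, let $A$ and $B$ be Hermitian $n\times n$ complex matrices with $B$ invertible, and put $T(t)=\operatorname{tr}|A+tB|^{3}$ for $t\in\mathbb{R}$, where $|M|=(M^{*}M)^{1/2}$. Then: 1. The set $S$ of all real $t$ for which $A+tB$ is singular is finite, and $T$ is real analytic at every point of $\mathbb{R}\setminus S$. 2. $T^{(4)}(t)\ge 0$ for every $t\in\mathbb{R}\setminus S$. 3. For every $c\in S$ there are real numbers $C_c\ge 0$ and $D_c$ and a function $f_c$ that is $C^{4}$ near $c$ such that, for all $t$ in a neighbourhood of $c$, $$T(t)=C_c|t-c|^{3}+D_c|t-c|^{3}(t-c)+f_c(t).$$ 4. Consequently the fourth distributional derivative of $T$ on $\mathbb{R}$ is a non-negative, locally finite Borel measure, namely $$\mu=T^{(4)}(t)\,dt+\sum_{c\in S}12\,C_c\,\delta_c ,$$ where $T^{(4)}$ is the pointwise derivative on $\mathbb{R}\setminus S$; that is, $T$ is locally integrable and $\int_{\mathbb{R}}T\varphi^{(4)}\,dt=\int_{\mathbb{R}}\varphi\,d\mu$ for every smooth compactly supported $\varphi:\mathbb{R}\to\mathbb{R}$.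 -/

import Mathlib

open MeasureTheory Filter
open scoped Topology ContDiff MatrixOrder ComplexOrder

/-- The real number `tr |M|³` of a complex square matrix, where `|M| = (M* M)^{1/2}` is the absolute
value of the continuous functional calculus. As `|M|³` is positive semidefinite its trace is real,
so that taking the real part only changes the type. -/
noncomputable def traceAbsCube {n : ℕ} (M : Matrix (Fin n) (Fin n) ℂ) : ℝ :=
  ((CFC.abs M ^ 3).trace).re

/-- The function `t ↦ tr |A + t B|³` of a real variable. -/
noncomputable def pencilTrace {n : ℕ} (A B : Matrix (Fin n) (Fin n) ℂ) (t : ℝ) : ℝ :=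
  traceAbsCube (A + t • B)

/-- The `k`-th distributional derivative of the locally integrable function `f` on `ℝ` is the
(non-negative, locally finite) Borel measure `μ`: one has
`(-1)ᵏ ∫ f φ⁽ᵏ⁾ = ∫ φ dμ` for all smooth compactly supported `φ`. -/
def HasDistribDerivMeasure (k : ℕ) (f : ℝ → ℝ) (μ : Measure ℝ) : Prop :=
  LocallyIntegrable f ∧ IsLocallyFiniteMeasure μ ∧
    ∀ φ : ℝ → ℝ, ContDiff ℝ ∞ φ → HasCompactSupport φ →
      (-1 : ℝ) ^ k * ∫ t, f t * iteratedDeriv k φ t = ∫ t, φ t ∂μ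

/-!
By Rellich's theorem the eigenvalues of `A + t B` near a real point `c` are analytic functions `μⱼ`,
and `T = ∑ |μⱼ|³`. Where `A + t B` is invertible this is the analytic function `∑ sign(μⱼ) μⱼ³`. In
general `|μⱼ|³` is an analytic function plus `|t - c|³` times an analytic function that is
non-negative at `c`; of the latter only the first two Taylor terms matter up to `C⁴` functions.

For the sign of the fourth derivative translate to `t = 0` with `A` invertible. Let `vⱼ` be the
analytic solutions of `1 + v μⱼ(w / v) = 0`, which near `w = 0` are all solutions of
`det (1 + v A + w B) = 0`. Lagrange inversion gives `(μⱼ³)⁗(0) = 3 vⱼ⁗(0)`, and `μⱼ`, `vⱼ` have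
opposite signs at `0`, so that `T⁗(0) = -3 V⁗(0)` with `V = ∑ |vⱼ|`. Now `-V(w) / w` continues to
the upper half plane as the sum of those solutions `r` of `det (r A + B + 1 / w) = 0` with
`Im r > 0` minus the sum of those with `Im r < 0`: no solution is real since `A` and `B` are
Hermitian. This sum has non-negative imaginary part and is bounded away from the origin, and
subtracting its polar part at the origin and using the Phragmén–Lindelöf principle one reads off
`V⁗(0) ≤ 0`.

Finally `|t - c|³` contributes the atom `12 δ_c` to the fourth distributional derivative, whereas
`|t - c|³ (t - c)` and `C⁴` functions contribute only their pointwise derivatives.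
-/

section Factorization

open Polynomial

section Coefficients

variable {R : Type*} [CommRing R] {k : ℕ}

/-- The polynomial of degree less than `k` with the given coefficients, as a linear function of
them. -/
noncomputable def polyOfCoeffs (k : ℕ) : (Fin k → R) →ₗ[R] R[X] :=
  (degreeLT R k).subtype ∘ₗ (degreeLTEquiv R k).symm

/-- The monic polynomial of degree `k` with the given lower coefficients. -/
noncomputable def monicOfCoeffs (q : Fin k → R) : R[X] :=
  X ^ k + polyOfCoeffs k q

theorem degree_polyOfCoeffs_lt (q : Fin k → R) : (polyOfCoeffs k q).degree < k :=
  mem_degreeLT.1 ((degreeLTEquiv R k).symm q).2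

theorem coeff_polyOfCoeffs (q : Fin k → R) (i : Fin k) : (polyOfCoeffs k q).coeff i = q i :=
  congrFun ((degreeLTEquiv R k).apply_symm_apply q) i

theorem polyOfCoeffs_eq_zero {q : Fin k → R} (h : polyOfCoeffs k q = 0) : q = 0 :=
  funext fun i => by rw [← coeff_polyOfCoeffs q i, h, coeff_zero, Pi.zero_apply]

theorem monic_monicOfCoeffs (q : Fin k → R) : (monicOfCoeffs q).Monic :=
  monic_X_pow_add (degree_polyOfCoeffs_lt q)

theorem degree_monicOfCoeffs [Nontrivial R] (q : Fin k → R) : (monicOfCoeffs q).degree = k := by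
  have h := degree_polyOfCoeffs_lt q
  rw [← degree_X_pow (R := R)] at h
  rw [monicOfCoeffs, degree_add_eq_left_of_degree_lt h, degree_X_pow]

theorem natDegree_monicOfCoeffs [Nontrivial R] (q : Fin k → R) :
    (monicOfCoeffs q).natDegree = k :=
  natDegree_eq_of_degree_eq_some (degree_monicOfCoeffs q)

theorem coeff_monicOfCoeffs (q : Fin k → R) (i : Fin k) : (monicOfCoeffs q).coeff i = q i := by
  rw [monicOfCoeffs, coeff_add, coeff_polyOfCoeffs, coeff_X_pow, if_neg i.2.ne, zero_add]

theorem monicOfCoeffs_add (q d : Fin k → R) :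
    monicOfCoeffs (q + d) = monicOfCoeffs q + polyOfCoeffs k d := by
  rw [monicOfCoeffs, monicOfCoeffs, map_add, add_assoc]

theorem eq_of_monic_of_coeff_eq {p q : R[X]} {n : ℕ} (hp : p.Monic) (hq : q.Monic)
    (hpn : p.natDegree = n) (hqn : q.natDegree = n) (h : ∀ i < n, p.coeff i = q.coeff i) :
    p = q := by
  ext i
  rcases lt_trichotomy i n with hi | rfl | hi
  · exact h i hi
  · rw [← hpn, hp.coeff_natDegree, hpn, ← hqn, hq.coeff_natDegree]
  · rw [coeff_eq_zero_of_natDegree_lt (hpn ▸ hi), coeff_eq_zero_of_natDegree_lt (hqn ▸ hi)]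

theorem monicOfCoeffs_coeff [Nontrivial R] {p : R[X]} (hp : p.Monic) (hk : p.natDegree = k) :
    monicOfCoeffs (fun i : Fin k => p.coeff i) = p :=
  eq_of_monic_of_coeff_eq (monic_monicOfCoeffs _) hp (natDegree_monicOfCoeffs _) hk
    fun i hi => coeff_monicOfCoeffs (fun i : Fin k => p.coeff i) ⟨i, hi⟩

theorem eq_zero_and_eq_zero_of_mul_add_mul_eq_zero {K : Type*} [Field K] {q r u v : K[X]}
    (hqr : IsCoprime q r) (hu : u.degree < q.degree) (hv : v.degree < r.degree)
    (h : u * r + q * v = 0) : u = 0 ∧ v = 0 := by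
  have hqu : q ∣ u * r := ⟨-v, by linear_combination h⟩
  have hrv : r ∣ q * v := ⟨-u, by linear_combination h⟩
  exact ⟨eq_zero_of_dvd_of_degree_lt (hqr.dvd_of_dvd_mul_right hqu) hu,
    eq_zero_of_dvd_of_degree_lt (hqr.symm.dvd_of_dvd_mul_left hrv) hv⟩

end Coefficients

variable {𝕜 : Type*} [RCLike 𝕜] {k l : ℕ}

/-- The lower coefficients of the product of two monic polynomials as a function of theirs. Its
derivative is invertible at a coprime pair, which makes factorizations extend analytically. -/
noncomputable def mulCoeffs (x : (Fin k → 𝕜) × (Fin l → 𝕜)) : Fin (k + l) → 𝕜 :=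
  fun m => (monicOfCoeffs x.1 * monicOfCoeffs x.2).coeff m

theorem contDiff_coeff_monicOfCoeffs (i : ℕ) :
    ContDiff 𝕜 ω fun q : Fin k → 𝕜 => (monicOfCoeffs q).coeff i := by
  have h : ContDiff 𝕜 ω ((lcoeff 𝕜 i ∘ₗ polyOfCoeffs k).toContinuousLinearMap) :=
    ContinuousLinearMap.contDiff _
  simpa only [monicOfCoeffs, coeff_add] using! contDiff_const.add h

theorem contDiff_mulCoeffs : ContDiff 𝕜 ω (mulCoeffs (𝕜 := 𝕜) (k := k) (l := l)) := by
  rw [contDiff_pi]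
  intro m
  simp only [mulCoeffs, coeff_mul]
  exact ContDiff.sum fun ij _ => ((contDiff_coeff_monicOfCoeffs ij.1).comp contDiff_fst).mul
    ((contDiff_coeff_monicOfCoeffs ij.2).comp contDiff_snd)

theorem mulCoeffs_add_smul (x d : (Fin k → 𝕜) × (Fin l → 𝕜)) (s : 𝕜) (m : Fin (k + l)) :
    mulCoeffs (x + s • d) m = (monicOfCoeffs x.1 * monicOfCoeffs x.2).coeff m +
      s *
        (polyOfCoeffs k d.1 * monicOfCoeffs x.2 + monicOfCoeffs x.1 * polyOfCoeffs l d.2).coeff m +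
      s ^ 2 * (polyOfCoeffs k d.1 * polyOfCoeffs l d.2).coeff m := by
  simp only [mulCoeffs, Prod.fst_add, Prod.snd_add, Prod.smul_fst, Prod.smul_snd,
    monicOfCoeffs_add, map_smul, smul_eq_C_mul]
  rw [← coeff_C_mul, ← coeff_C_mul, ← coeff_add, ← coeff_add, C_pow]
  congr 1
  ring

theorem fderiv_mulCoeffs_apply (x d : (Fin k → 𝕜) × (Fin l → 𝕜)) (m : Fin (k + l)) :
    fderiv 𝕜 mulCoeffs x d m =
      (polyOfCoeffs k d.1 * monicOfCoeffs x.2 +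
        monicOfCoeffs x.1 * polyOfCoeffs l d.2).coeff m := by
  have hdiff : DifferentiableAt 𝕜 mulCoeffs x := contDiff_mulCoeffs.differentiable (by simp) x
  have hline := hasDerivAt_pi.1 (hdiff.hasFDerivAt.hasLineDerivAt d) m
  simp only [mulCoeffs_add_smul] at hline
  refine hline.unique ?_
  exact ((((hasDerivAt_id (0 : 𝕜)).mul_const _).const_add _).fun_add
    ((hasDerivAt_pow 2 (0 : 𝕜)).mul_const _)).congr_deriv (by simp)

theorem injective_fderiv_mulCoeffs {x : (Fin k → 𝕜) × (Fin l → 𝕜)}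
    (hx : IsCoprime (monicOfCoeffs x.1) (monicOfCoeffs x.2)) :
    Function.Injective (fderiv 𝕜 mulCoeffs x) := by
  rw [injective_iff_map_eq_zero]
  intro d hd
  have hq : (polyOfCoeffs k d.1).degree < (monicOfCoeffs x.1).degree :=
    (degree_monicOfCoeffs x.1).symm ▸ degree_polyOfCoeffs_lt d.1
  have hr : (polyOfCoeffs l d.2).degree < (monicOfCoeffs x.2).degree :=
    (degree_monicOfCoeffs x.2).symm ▸ degree_polyOfCoeffs_lt d.2
  have hzero :
      polyOfCoeffs k d.1 * monicOfCoeffs x.2 + monicOfCoeffs x.1 * polyOfCoeffs l d.2 = 0 := by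
    ext m
    by_cases hm : m < k + l
    · simpa [fderiv_mulCoeffs_apply] using congrFun hd ⟨m, hm⟩
    · rw [coeff_zero]
      refine coeff_eq_zero_of_degree_lt (lt_of_lt_of_le ?_ (Nat.cast_le.2 (not_lt.1 hm)))
      refine (degree_add_le _ _).trans_lt (max_lt ?_ ?_)
      · rw [degree_mul, degree_monicOfCoeffs x.2, Nat.cast_add]
        exact WithBot.add_lt_add_right (by simp) (degree_polyOfCoeffs_lt d.1)
      · rw [degree_mul, degree_monicOfCoeffs x.1, Nat.cast_add]
        exact WithBot.add_lt_add_left (by simp) (degree_polyOfCoeffs_lt d.2)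
  obtain ⟨h₁, h₂⟩ := eq_zero_and_eq_zero_of_mul_add_mul_eq_zero hx hq hr hzero
  exact Prod.ext (polyOfCoeffs_eq_zero h₁) (polyOfCoeffs_eq_zero h₂)

theorem exists_analyticAt_mulCoeffs_eq {x : (Fin k → 𝕜) × (Fin l → 𝕜)}
    (hx : IsCoprime (monicOfCoeffs x.1) (monicOfCoeffs x.2)) {c : 𝕜 → Fin (k + l) → 𝕜} {t₀ : 𝕜}
    (hc : AnalyticAt 𝕜 c t₀) (hxc : mulCoeffs x = c t₀) :
    ∃ y : 𝕜 → (Fin k → 𝕜) × (Fin l → 𝕜), AnalyticAt 𝕜 y t₀ ∧ y t₀ = x ∧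
      ∀ᶠ t in 𝓝 t₀, mulCoeffs (y t) = c t := by
  let e : ((Fin k → 𝕜) × (Fin l → 𝕜)) ≃L[𝕜] (Fin (k + l) → 𝕜) :=
    (LinearEquiv.ofInjectiveOfFinrankEq (fderiv 𝕜 mulCoeffs x : _ →ₗ[𝕜] _)
      (injective_fderiv_mulCoeffs hx) (by simp)).toContinuousLinearEquiv
  have hcd : ContDiffAt 𝕜 ω (mulCoeffs (𝕜 := 𝕜) (k := k) (l := l)) x :=
    contDiff_mulCoeffs.contDiffAt
  have hfd : HasFDerivAt mulCoeffs (e : _ →L[𝕜] _) x := by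
    have he : (e : _ →L[𝕜] _) = fderiv 𝕜 mulCoeffs x := by ext <;> rfl
    exact he ▸ (hcd.differentiableAt (by simp)).hasFDerivAt
  let g := hcd.localInverse hfd (by simp)
  have hg : AnalyticAt 𝕜 g (c t₀) := hxc ▸ (hcd.to_localInverse hfd (by simp)).analyticAt
  have hright : ∀ᶠ y in 𝓝 (c t₀), mulCoeffs (g y) = y :=
    hxc ▸ (hcd.hasStrictFDerivAt' hfd (by simp)).eventually_right_inverse
  have hgx : g (c t₀) = x := hxc ▸ hcd.localInverse_apply_image hfd (by simp)
  exact ⟨g ∘ c, hg.comp hc, hgx, hc.continuousAt.eventually hright⟩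

/-- A family of monic polynomials of degree `n` whose coefficients are analytic at `t₀`. -/
structure AnalyticMonicFamily (p : 𝕜 → 𝕜[X]) (n : ℕ) (t₀ : 𝕜) : Prop where
  monic : ∀ t, (p t).Monic
  natDegree : ∀ t, (p t).natDegree = n
  analyticAt : ∀ i, AnalyticAt 𝕜 (fun t => (p t).coeff i) t₀

namespace AnalyticMonicFamily

theorem of_coeffs {c : 𝕜 → Fin k → 𝕜} {t₀ : 𝕜} (hc : AnalyticAt 𝕜 c t₀) :
    AnalyticMonicFamily (fun t => monicOfCoeffs (c t)) k t₀ where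
  monic _ := monic_monicOfCoeffs _
  natDegree _ := natDegree_monicOfCoeffs _
  analyticAt i := (contDiff_coeff_monicOfCoeffs i).contDiffAt.analyticAt.comp hc

theorem exists_factorization {p : 𝕜 → 𝕜[X]} {n : ℕ} {t₀ : 𝕜}
    (hp : AnalyticMonicFamily p n t₀) {q r : 𝕜[X]} (hq : q.Monic) (hr : r.Monic)
    (hqr : IsCoprime q r) (h : p t₀ = q * r) :
    ∃ Q R : 𝕜 → 𝕜[X], AnalyticMonicFamily Q q.natDegree t₀ ∧
      AnalyticMonicFamily R r.natDegree t₀ ∧ Q t₀ = q ∧ R t₀ = r ∧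
      ∀ᶠ t in 𝓝 t₀, p t = Q t * R t := by
  obtain rfl : n = q.natDegree + r.natDegree := by
    rw [← hp.natDegree t₀, h, hq.natDegree_mul hr]
  let x : (Fin q.natDegree → 𝕜) × (Fin r.natDegree → 𝕜) := (fun i => q.coeff i, fun i => r.coeff i)
  have hxq : monicOfCoeffs x.1 = q := monicOfCoeffs_coeff hq rfl
  have hxr : monicOfCoeffs x.2 = r := monicOfCoeffs_coeff hr rfl
  obtain ⟨y, hy, hyx, hyp⟩ := exists_analyticAt_mulCoeffs_eq (x := x) (by rwa [hxq, hxr])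
    (AnalyticAt.pi fun i => hp.analyticAt i)
    (funext fun m => by simp only [mulCoeffs, hxq, hxr, h])
  refine ⟨fun t => monicOfCoeffs (y t).1, fun t => monicOfCoeffs (y t).2,
    of_coeffs (analyticAt_fst.comp hy), of_coeffs (analyticAt_snd.comp hy),
    by simp only [hyx, hxq], by simp only [hyx, hxr], ?_⟩
  filter_upwards [hyp] with t ht
  have hmonic := (monic_monicOfCoeffs (y t).1).mul (monic_monicOfCoeffs (y t).2)
  refine eq_of_monic_of_coeff_eq (hp.monic t) hmonic (hp.natDegree t) ?_
    fun i hi => (congrFun ht ⟨i, hi⟩).symm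
  rw [(monic_monicOfCoeffs _).natDegree_mul (monic_monicOfCoeffs _), natDegree_monicOfCoeffs,
    natDegree_monicOfCoeffs]

end AnalyticMonicFamily

end Factorization

section RealRooted

open Polynomial Asymptotics

section RootsAndCoefficients

theorem two_mul_coeff_multiset_prod_X_sub_C {R : Type*} [CommRing R] [Nontrivial R]
    (s : Multiset R) {n : ℕ} (hs : s.card = n + 2) :
    2 * ((s.map fun a => X - C a).prod).coeff n = s.sum ^ 2 - (s.map fun a => a ^ 2).sum := by
  induction s using Multiset.induction_on generalizing n with
  | empty => simp at hs
  | cons a s ih =>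
    rw [Multiset.card_cons] at hs
    have hcard : s.card = n + 1 := by lia
    have hpred : ((s.map fun a => X - C a).prod).coeff n = -s.sum := by
      simpa [hcard] using multiset_prod_X_sub_C_coeff_card_pred s (by lia)
    rw [Multiset.map_cons, Multiset.prod_cons, sub_mul, coeff_sub, coeff_C_mul, hpred,
      Multiset.sum_cons, Multiset.map_cons, Multiset.sum_cons]
    cases n with
    | zero =>
      obtain ⟨b, rfl⟩ := Multiset.card_eq_one.1 hcard
      simp only [Multiset.map_singleton, Multiset.prod_singleton, mul_coeff_zero, coeff_X_zero,
        coeff_sub, coeff_C_zero, zero_sub, mul_neg, zero_mul, neg_zero, Multiset.sum_singleton,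
        sub_neg_eq_add, zero_add]
      ring
    | succ m =>
      rw [coeff_X_mul, mul_sub, ih hcard]
      ring

theorem sq_root_le_of_splits {K : Type*} [Field K] [LinearOrder K] [IsStrictOrderedRing K]
    {p : K[X]} (hs : p.Splits) (hm : p.Monic) {n : ℕ} (hn : p.natDegree = n + 2)
    (h : p.coeff (n + 1) = 0) : ∀ x ∈ p.roots, x ^ 2 ≤ -2 * p.coeff n := by
  intro x hx
  have hcard : p.roots.card = n + 2 := by rw [← hs.natDegree_eq_card_roots, hn]
  have hp := hs.eq_prod_roots_of_monic hm
  have hsum : p.roots.sum = 0 := by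
    have := multiset_prod_X_sub_C_coeff_card_pred p.roots (by lia)
    rwa [hcard, ← hp, show n + 2 - 1 = n + 1 from rfl, h, eq_comm, neg_eq_zero] at this
  have hsq : 2 * p.coeff n = -(p.roots.map fun a => a ^ 2).sum := by
    have := two_mul_coeff_multiset_prod_X_sub_C p.roots hcard
    rwa [← hp, hsum, zero_pow two_ne_zero, zero_sub] at this
  have hle : x ^ 2 ≤ (p.roots.map fun a => a ^ 2).sum :=
    Multiset.single_le_sum (fun y hy => by
      obtain ⟨z, -, rfl⟩ := Multiset.mem_map.1 hy
      positivity) _ (Multiset.mem_map_of_mem _ hx)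
  linarith

theorem eq_X_pow_of_splits {K : Type*} [Field K] [LinearOrder K] [IsStrictOrderedRing K]
    {p : K[X]} (hs : p.Splits) (hm : p.Monic) {n : ℕ} (hn : p.natDegree = n + 2)
    (h : p.coeff (n + 1) = 0) (h' : p.coeff n = 0) : p = X ^ (n + 2) := by
  have hroots : p.roots = Multiset.replicate (n + 2) 0 := by
    refine Multiset.eq_replicate.2 ⟨by rw [← hs.natDegree_eq_card_roots, hn], fun x hx => ?_⟩
    have := sq_root_le_of_splits hs hm hn h x hx
    rw [h', mul_zero] at this
    exact (pow_eq_zero_iff two_ne_zero).1 (le_antisymm this (sq_nonneg x))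
  rw [hs.eq_prod_roots_of_monic hm, hroots, Multiset.map_replicate, Multiset.prod_replicate, C_0,
    sub_zero]

theorem exists_coprime_factorization {K : Type*} [Field K] {p : K[X]} (hm : p.Monic)
    {a : K} (ha : p.IsRoot a) (hpow : p ≠ (X - C a) ^ p.natDegree) :
    ∃ q r : K[X], q.Monic ∧ r.Monic ∧ IsCoprime q r ∧ p = q * r ∧
      q.natDegree < p.natDegree ∧ r.natDegree < p.natDegree := by
  obtain ⟨r, hr, hndvd⟩ := p.exists_eq_pow_rootMultiplicity_mul_and_not_dvd hm.ne_zero a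
  have hpos := (rootMultiplicity_pos hm.ne_zero).2 ha
  set m := p.rootMultiplicity a
  have hqm : ((X - C a) ^ m).Monic := (monic_X_sub_C a).pow m
  have hrm : r.Monic := hqm.of_mul_monic_left (hr ▸ hm)
  have hqd : ((X - C a) ^ m).natDegree = m := by
    rw [(monic_X_sub_C a).natDegree_pow, natDegree_X_sub_C, mul_one]
  have hdeg : p.natDegree = m + r.natDegree := by rw [hr, hqm.natDegree_mul hrm, hqd]
  refine ⟨(X - C a) ^ m, r, hqm, hrm,
    IsCoprime.pow_left ((irreducible_X_sub_C a).coprime_iff_not_dvd.2 hndvd), hr, ?_, by lia⟩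
  rw [hqd, hdeg, Nat.lt_add_right_iff_pos, Nat.pos_iff_ne_zero]
  intro hr0
  rw [hrm.natDegree_eq_zero.1 hr0, mul_one] at hr
  rw [hdeg, hr0, add_zero] at hpow
  exact hpow hr

theorem coeff_eq_zero_of_eq_X_sub_C_pow {K : Type*} [Field K] [CharZero K] {a : K} {n : ℕ}
    (h : ((X - C a) ^ (n + 2)).coeff (n + 1) = 0) : ((X - C a) ^ (n + 2)).coeff n = 0 := by
  have ha : a = 0 := by
    rw [sub_eq_add_neg, ← C_neg, coeff_X_add_C_pow] at h
    simpa [show n + 2 - (n + 1) = 1 by lia, show ((n : K) + 1 + 1) ≠ 0 by norm_cast] using h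
  rw [ha, C_0, sub_zero, coeff_X_pow, if_neg (by lia)]

theorem taylor_coeff_of_natDegree_eq {R : Type*} [CommRing R] {p : R[X]} (hm : p.Monic) {n : ℕ}
    (hn : p.natDegree = n + 1) (s : R) : (taylor s p).coeff n = p.coeff n + (n + 1) * s := by
  have hlead : p.coeff (n + 1) = 1 := hn ▸ hm
  rw [taylor_coeff, eval_eq_sum_range' (n := 2)]
  · simp [Finset.sum_range_succ, hasseDeriv_coeff, add_comm 1 n, hlead]
  · refine lt_of_le_of_lt (natDegree_hasseDeriv_le _ _) ?_
    rw [hn]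
    lia

end RootsAndCoefficients

variable {𝕜 : Type*} [RCLike 𝕜]

theorem le_analyticOrderAt_of_isBigO {f : 𝕜 → 𝕜} {t₀ : 𝕜} (hf : AnalyticAt 𝕜 f t₀) {m : ℕ}
    (h : f =O[𝓝[≠] t₀] fun t => (t - t₀) ^ m) : m ≤ analyticOrderAt f t₀ := by
  by_contra! hlt
  obtain ⟨o, ho⟩ := ENat.ne_top_iff_exists.1 (lt_top_of_lt hlt).ne
  rw [← ho, Nat.cast_lt] at hlt
  obtain ⟨g, hg, hg0, hfg⟩ := hf.analyticOrderAt_eq_natCast.1 ho.symm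
  have hone : (fun _ => (1 : 𝕜)) =O[𝓝[≠] t₀] g :=
    (isBigO_const_const 1 hg0 _).trans (((isEquivalent_const_iff_tendsto hg0).2
      (hg.continuousAt.tendsto.mono_left nhdsWithin_le_nhds)).isBigO_symm)
  have hle : (fun t => (t - t₀) ^ o) =O[𝓝[≠] t₀] f := by
    refine ((isBigO_refl (fun t => (t - t₀) ^ o) _).mul hone).congr' (by simp) ?_
    filter_upwards [hfg.filter_mono nhdsWithin_le_nhds] with t ht using ht.symm
  have hlittle : (fun t => (t - t₀) ^ m) =o[𝓝[≠] t₀] fun t => (t - t₀) ^ o := by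
    refine isLittleO_norm_norm.1 ?_
    simpa only [norm_pow] using (isLittleO_pow_sub_pow_sub t₀ hlt).mono nhdsWithin_le_nhds
  refine (hle.trans h).not_isLittleO ?_ hlittle
  refine (eventually_mem_nhdsWithin.mono fun t ht => ?_).frequently
  exact pow_ne_zero o (sub_ne_zero.2 ht)

theorem even_of_eventually_pow_mul_nonpos {u : ℝ → ℝ} {t₀ : ℝ} (hu : ContinuousAt u t₀)
    (h₀ : u t₀ ≠ 0) {m : ℕ} (h : ∀ᶠ t in 𝓝 t₀, (t - t₀) ^ m * u t ≤ 0) : Even m := by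
  by_contra hodd
  rw [Nat.not_even_iff_odd] at hodd
  refine h₀ (le_antisymm ?_ ?_)
  · refine le_of_tendsto (hu.tendsto.mono_left (nhdsWithin_le_nhds (s := Set.Ioi t₀))) ?_
    filter_upwards [h.filter_mono nhdsWithin_le_nhds, self_mem_nhdsWithin] with t ht hlt
    exact nonpos_of_mul_nonpos_right ht (pow_pos (sub_pos.2 hlt) m)
  · refine ge_of_tendsto (hu.tendsto.mono_left (nhdsWithin_le_nhds (s := Set.Iio t₀))) ?_
    filter_upwards [h.filter_mono nhdsWithin_le_nhds, self_mem_nhdsWithin] with t ht hlt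
    exact nonneg_of_mul_nonpos_right ht (hodd.pow_neg (sub_neg.2 hlt))

theorem analyticAt_eval_polynomial {n : ℕ} {p : 𝕜 → 𝕜[X]} {t₀ : 𝕜} (hd : ∀ t, (p t).natDegree ≤ n)
    (ha : ∀ i, AnalyticAt 𝕜 (fun t => (p t).coeff i) t₀) {s : 𝕜 → 𝕜} (hs : AnalyticAt 𝕜 s t₀) :
    AnalyticAt 𝕜 (fun t => (p t).eval (s t)) t₀ := by
  simp only [fun t => eval_eq_sum_range' (Nat.lt_succ_of_le (hd t)) (s t)]
  exact Finset.analyticAt_fun_sum _ fun i _ => (ha i).mul (hs.pow i)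

/-- The roots of the polynomials `p t` of degree `n` can be chosen as `n` functions of `t` that are
analytic at `t₀`. -/
def HasAnalyticRoots (p : 𝕜 → 𝕜[X]) (n : ℕ) (t₀ : 𝕜) : Prop :=
  ∃ f : Fin n → 𝕜 → 𝕜, (∀ i, AnalyticAt 𝕜 (f i) t₀) ∧
    ∀ᶠ t in 𝓝 t₀, p t = ∏ i, (X - C (f i t))

namespace HasAnalyticRoots

variable {p q : 𝕜 → 𝕜[X]} {m n : ℕ} {t₀ : 𝕜}

theorem congr (h : HasAnalyticRoots p n t₀) (hpq : ∀ᶠ t in 𝓝 t₀, q t = p t) :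
    HasAnalyticRoots q n t₀ :=
  let ⟨f, hf, hpf⟩ := h
  ⟨f, hf, by filter_upwards [hpq, hpf] with t h₁ h₂ using h₁.trans h₂⟩

theorem mul (hp : HasAnalyticRoots p m t₀) (hq : HasAnalyticRoots q n t₀) :
    HasAnalyticRoots (fun t => p t * q t) (m + n) t₀ := by
  obtain ⟨f, hf, hpf⟩ := hp
  obtain ⟨g, hg, hqg⟩ := hq
  refine ⟨Fin.append f g, Fin.addCases (by simpa using hf) (by simpa using hg), ?_⟩
  filter_upwards [hpf, hqg] with t h₁ h₂
  simp [h₁, h₂, Fin.prod_univ_add]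

theorem taylor (h : HasAnalyticRoots p n t₀) {s : 𝕜 → 𝕜} (hs : AnalyticAt 𝕜 s t₀) :
    HasAnalyticRoots (fun t => Polynomial.taylor (s t) (p t)) n t₀ := by
  obtain ⟨f, hf, hpf⟩ := h
  refine ⟨fun i t => f i t - s t, fun i => (hf i).sub hs, ?_⟩
  filter_upwards [hpf] with t ht
  rw [ht]
  refine (map_prod (taylorAlgHom (s t)) _ _).trans (Finset.prod_congr rfl fun i _ => ?_)
  simp only [taylorAlgHom_apply, map_sub, taylor_X, taylor_C]
  ring

theorem scaleRoots (h : HasAnalyticRoots p n t₀) {s : 𝕜 → 𝕜} (hs : AnalyticAt 𝕜 s t₀) :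
    HasAnalyticRoots (fun t => Polynomial.scaleRoots (p t) (s t)) n t₀ := by
  obtain ⟨f, hf, hpf⟩ := h
  refine ⟨fun i t => f i t * s t, fun i => (hf i).mul hs, ?_⟩
  filter_upwards [hpf] with t ht
  rw [ht]
  exact Finset.prod_hom_rel (r := fun P Q => Polynomial.scaleRoots P (s t) = Q) (by simp)
    fun i P Q hPQ => by rw [mul_scaleRoots_of_noZeroDivisors, X_sub_C_scaleRoots, hPQ]

theorem X_pow : HasAnalyticRoots (fun _ => X ^ n) n t₀ :=
  ⟨fun _ _ => 0, fun _ => analyticAt_const, Eventually.of_forall fun t => by simp⟩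

end HasAnalyticRoots

namespace AnalyticMonicFamily

variable {n : ℕ}

theorem taylor {p : 𝕜 → 𝕜[X]} {t₀ : 𝕜} (hp : AnalyticMonicFamily p n t₀) {s : 𝕜 → 𝕜}
    (hs : AnalyticAt 𝕜 s t₀) :
    AnalyticMonicFamily (fun t => Polynomial.taylor (s t) (p t)) n t₀ where
  monic t := by
    rw [Monic, leadingCoeff_taylor]
    exact hp.monic t
  natDegree t := by rw [natDegree_taylor, hp.natDegree]
  analyticAt i := by
    simp only [taylor_coeff]
    refine analyticAt_eval_polynomial (n := n) (fun t => ?_) (fun j => ?_) hs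
    · exact (natDegree_hasseDeriv_le _ _).trans (by rw [hp.natDegree]; exact Nat.sub_le _ _)
    · simp only [hasseDeriv_coeff]
      exact analyticAt_const.mul (hp.analyticAt _)

theorem hasAnalyticRoots_zero {p : 𝕜 → 𝕜[X]} {t₀ : 𝕜} (hp : AnalyticMonicFamily p 0 t₀) :
    HasAnalyticRoots p 0 t₀ :=
  ⟨finZeroElim, finZeroElim, Eventually.of_forall fun t => by
    simpa using (hp.monic t).natDegree_eq_zero.1 (hp.natDegree t)⟩

theorem hasAnalyticRoots_one {p : 𝕜 → 𝕜[X]} {t₀ : 𝕜} (hp : AnalyticMonicFamily p 1 t₀) :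
    HasAnalyticRoots p 1 t₀ :=
  ⟨fun _ t => -(p t).coeff 0, fun _ => (hp.analyticAt 0).neg, Eventually.of_forall fun t => by
    simpa using (hp.monic t).eq_X_add_C (hp.natDegree t)⟩

end AnalyticMonicFamily
end RealRooted

section Rellich

open Polynomial Asymptotics

theorem abs_im_pow_natDegree_le_norm_aeval {p : ℝ[X]} (hs : p.Splits) (hm : p.Monic) (z : ℂ) :
    |z.im| ^ p.natDegree ≤ ‖aeval z p‖ := by
  have heval : aeval z p = (p.roots.map fun a : ℝ => z - a).prod := by
    conv_lhs => rw [hs.eq_prod_roots_of_monic hm, map_multiset_prod, Multiset.map_map]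
    simp
  rw [heval, hs.natDegree_eq_card_roots]
  induction p.roots using Multiset.induction_on with
  | empty => simp
  | cons a s ih =>
    rw [Multiset.card_cons, Multiset.map_cons, Multiset.prod_cons, norm_mul, pow_succ']
    refine mul_le_mul ?_ ih (by positivity) (norm_nonneg _)
    simpa using Complex.abs_im_le_norm (z - a)

namespace AnalyticMonicFamily

variable {n : ℕ} {t₀ : ℝ}

theorem splits_of_eventually_nhdsNE {p : ℝ → ℝ[X]} (hp : AnalyticMonicFamily p n t₀)
    (hs : ∀ᶠ t in 𝓝[≠] t₀, (p t).Splits) : (p t₀).Splits := by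
  refine Splits.of_splits_map_of_injective (i := algebraMap ℝ ℂ) (algebraMap ℝ ℂ).injective
    (IsAlgClosed.splits _) fun z hz => ?_
  have hzero : aeval z (p t₀) = 0 := by
    simpa [aeval_def, eval_map] using (mem_roots'.1 hz).2
  have hcont : ContinuousAt (fun t => ‖aeval z (p t)‖) t₀ := by
    simp only [fun t => aeval_eq_sum_range' (Nat.lt_succ_of_le (hp.natDegree t).le) z]
    exact (tendsto_finsetSum _ fun i _ =>
      (hp.analyticAt i).continuousAt.smul continuousAt_const).norm
  have hlow : ∀ᶠ t in 𝓝[≠] t₀, |z.im| ^ n ≤ ‖aeval z (p t)‖ := by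
    filter_upwards [hs] with t ht
    rw [← hp.natDegree t]
    exact abs_im_pow_natDegree_le_norm_aeval ht (hp.monic t) z
  have him := ge_of_tendsto (hcont.tendsto.mono_left nhdsWithin_le_nhds) hlow
  rw [hzero, norm_zero] at him
  have hreal : z.im = 0 := abs_eq_zero.1 (eq_zero_of_pow_eq_zero (him.antisymm (by positivity)))
  exact ⟨z.re, by apply Complex.ext <;> simp [hreal]⟩

theorem eventually_splits {p : ℝ → ℝ[X]} (hp : AnalyticMonicFamily p n t₀)
    (hs : ∀ᶠ t in 𝓝[≠] t₀, (p t).Splits) : ∀ᶠ t in 𝓝 t₀, (p t).Splits := by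
  rw [← nhdsNE_sup_pure, eventually_sup]
  exact ⟨hs, hp.splits_of_eventually_nhdsNE hs⟩

theorem exists_eventually_eq_scaleRoots {q : ℝ → ℝ[X]} (hq : AnalyticMonicFamily q n t₀)
    (hs : ∀ᶠ t in 𝓝 t₀, (q t).Splits) {k : ℕ} {K : ℝ}
    (hK : ∀ᶠ t in 𝓝 t₀, ∀ x ∈ (q t).roots, |x| ≤ K * |t - t₀| ^ k) :
    ∃ r : ℝ → ℝ[X], AnalyticMonicFamily r n t₀ ∧
      ∀ᶠ t in 𝓝 t₀, q t = scaleRoots (r t) ((t - t₀) ^ k) := by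
  have hcoeff (i : Fin n) : ∃ b, AnalyticAt ℝ b t₀ ∧
      ∀ᶠ t in 𝓝 t₀, (q t).coeff i = (t - t₀) ^ (k * (n - i)) * b t := by
    refine (natCast_le_analyticOrderAt (hq.analyticAt i)).1
      (le_analyticOrderAt_of_isBigO (hq.analyticAt i) ?_)
    refine IsBigO.of_bound (K ^ (n - i : ℕ) * n.choose i) ?_
    filter_upwards [hs.filter_mono nhdsWithin_le_nhds, hK.filter_mono nhdsWithin_le_nhds]
      with t hst hKt
    have := coeff_le_of_roots_le (p := q t) (f := RingHom.id ℝ) (B := K * |t - t₀| ^ k) i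
      (hq.monic t) (by simpa using hst) (by simpa using hKt)
    rw [Polynomial.map_id, hq.natDegree, mul_pow, ← pow_mul] at this
    rw [norm_pow, Real.norm_eq_abs (t - t₀)]
    linarith
  choose b hb hqb using hcoeff
  refine ⟨fun t => monicOfCoeffs fun i => b i t, of_coeffs (AnalyticAt.pi hb), ?_⟩
  filter_upwards [eventually_all.2 hqb] with t ht
  refine eq_of_monic_of_coeff_eq (hq.monic t)
    ((monic_scaleRoots_iff _).2 (monic_monicOfCoeffs _)) (hq.natDegree t)
    (by rw [natDegree_scaleRoots, natDegree_monicOfCoeffs]) fun i hi => ?_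
  rw [coeff_scaleRoots, natDegree_monicOfCoeffs, ht ⟨i, hi⟩, ← pow_mul, mul_comm,
    coeff_monicOfCoeffs (fun i => b i t) ⟨i, hi⟩]

theorem coeff_eq_of_coeff_scaleRoots_eq {r : ℝ → ℝ[X]} (hr : AnalyticMonicFamily r n t₀)
    {u : ℝ → ℝ} (hu : ContinuousAt u t₀) {i k : ℕ}
    (h : ∀ᶠ t in 𝓝 t₀,
      (scaleRoots (r t) ((t - t₀) ^ k)).coeff i = (t - t₀) ^ (k * (n - i)) * u t) :
    (r t₀).coeff i = u t₀ := by
  refine tendsto_nhds_unique_of_eventuallyEq (l := 𝓝[≠] t₀)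
    ((hr.analyticAt i).continuousAt.tendsto.mono_left nhdsWithin_le_nhds)
    (hu.tendsto.mono_left nhdsWithin_le_nhds) ?_
  filter_upwards [h.filter_mono nhdsWithin_le_nhds, self_mem_nhdsWithin] with t ht hne
  rw [coeff_scaleRoots, hr.natDegree, ← pow_mul, mul_comm] at ht
  exact mul_left_cancel₀ (pow_ne_zero _ (sub_ne_zero.2 hne)) ht

theorem eventually_splits_of_eq_scaleRoots {q r : ℝ → ℝ[X]} (hr : AnalyticMonicFamily r n t₀)
    (hs : ∀ᶠ t in 𝓝 t₀, (q t).Splits) {k : ℕ}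
    (hqr : ∀ᶠ t in 𝓝 t₀, q t = scaleRoots (r t) ((t - t₀) ^ k)) :
    ∀ᶠ t in 𝓝 t₀, (r t).Splits := by
  refine hr.eventually_splits ?_
  filter_upwards [hs.filter_mono nhdsWithin_le_nhds, hqr.filter_mono nhdsWithin_le_nhds,
    self_mem_nhdsWithin] with t hst ht hne
  have hrt : r t = scaleRoots (q t) ((t - t₀) ^ k)⁻¹ := by
    rw [ht, ← scaleRoots_mul, mul_inv_cancel₀ (pow_ne_zero _ (sub_ne_zero.2 hne)), scaleRoots_one]
  exact hrt ▸ hst.scaleRoots _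

theorem exists_root_bound {q : ℝ → ℝ[X]} (hq : AnalyticMonicFamily q (n + 2) t₀)
    (hs : ∀ᶠ t in 𝓝 t₀, (q t).Splits) (hc : ∀ t, (q t).coeff (n + 1) = 0) {k : ℕ} {u : ℝ → ℝ}
    (hu : ContinuousAt u t₀) (hqu : ∀ᶠ t in 𝓝 t₀, (q t).coeff n = (t - t₀) ^ (2 * k) * u t) :
    ∃ K : ℝ, ∀ᶠ t in 𝓝 t₀, ∀ x ∈ (q t).roots, |x| ≤ K * |t - t₀| ^ k := by
  refine ⟨√(2 * (|u t₀| + 1)), ?_⟩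
  filter_upwards [hs, hqu, hu.abs.eventually_lt continuousAt_const (lt_add_one |u t₀|)]
    with t hst hut hlt x hx
  refine abs_le_of_sq_le_sq ?_ (by positivity)
  calc x ^ 2 ≤ -2 * (q t).coeff n :=
        sq_root_le_of_splits hst (hq.monic t) (hq.natDegree t) (hc t) x hx
    _ = 2 * -u t * (t - t₀) ^ (2 * k) := by rw [hut]; ring
    _ ≤ 2 * (|u t₀| + 1) * (t - t₀) ^ (2 * k) := by
        gcongr
        · exact (even_two_mul k).pow_nonneg _
        · exact (neg_le_abs _).trans hlt.le
    _ = (√(2 * (|u t₀| + 1)) * |t - t₀| ^ k) ^ 2 := by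
        rw [mul_pow, Real.sq_sqrt (by positivity), ← pow_mul, mul_comm k 2,
          (even_two_mul k).pow_abs]

theorem exists_eq_scaleRoots_of_centered {q : ℝ → ℝ[X]} (hq : AnalyticMonicFamily q (n + 2) t₀)
    (hs : ∀ᶠ t in 𝓝 t₀, (q t).Splits) (hc : ∀ t, (q t).coeff (n + 1) = 0)
    (hne : ¬ ∀ᶠ t in 𝓝 t₀, (q t).coeff n = 0) :
    ∃ (k : ℕ) (r : ℝ → ℝ[X]), AnalyticMonicFamily r (n + 2) t₀ ∧
      (∀ᶠ t in 𝓝 t₀, q t = scaleRoots (r t) ((t - t₀) ^ k)) ∧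
      (r t₀).coeff (n + 1) = 0 ∧ (r t₀).coeff n ≠ 0 := by
  obtain ⟨m, u, hu, hu₀, hqu⟩ :=
    (hq.analyticAt n).exists_eventuallyEq_pow_smul_nonzero_iff.2 hne
  have hnonpos : ∀ᶠ t in 𝓝 t₀, (t - t₀) ^ m * u t ≤ 0 := by
    filter_upwards [hs, hqu] with t hst hut
    obtain ⟨x, hx⟩ := Multiset.exists_mem_of_ne_zero
      (hst.roots_ne_zero (by rw [hq.natDegree]; lia))
    have := (sq_nonneg x).trans
      (sq_root_le_of_splits hst (hq.monic t) (hq.natDegree t) (hc t) x hx)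
    rw [hut, smul_eq_mul] at this
    linarith
  obtain ⟨k, rfl⟩ := (even_of_eventually_pow_mul_nonpos hu.continuousAt hu₀ hnonpos).two_dvd
  obtain ⟨K, hK⟩ := hq.exists_root_bound hs hc hu.continuousAt hqu
  obtain ⟨r, hr, hqr⟩ := hq.exists_eventually_eq_scaleRoots hs hK
  refine ⟨k, r, hr, hqr, ?_, ?_⟩
  · refine hr.coeff_eq_of_coeff_scaleRoots_eq (u := 0) continuousAt_const (k := k) ?_
    filter_upwards [hqr] with t ht
    rw [← ht, hc, Pi.zero_apply, mul_zero]
  · rw [hr.coeff_eq_of_coeff_scaleRoots_eq hu.continuousAt (k := k)]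
    · exact hu₀
    · filter_upwards [hqr, hqu] with t ht hut
      rw [← ht, hut, smul_eq_mul, Nat.add_sub_cancel_left, mul_comm 2]

theorem exists_factorization_of_centered {r : ℝ → ℝ[X]} (hr : AnalyticMonicFamily r (n + 2) t₀)
    (hs : (r t₀).Splits) (hc : (r t₀).coeff (n + 1) = 0) (hne : (r t₀).coeff n ≠ 0) :
    ∃ (a b : ℕ) (Q R : ℝ → ℝ[X]), a < n + 2 ∧ b < n + 2 ∧ a + b = n + 2 ∧
      AnalyticMonicFamily Q a t₀ ∧ AnalyticMonicFamily R b t₀ ∧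
      ∀ᶠ t in 𝓝 t₀, r t = Q t * R t := by
  obtain ⟨a, ha⟩ := Multiset.exists_mem_of_ne_zero
    (hs.roots_ne_zero (by rw [hr.natDegree]; lia))
  have hpow : r t₀ ≠ (X - C a) ^ (r t₀).natDegree := fun h => by
    rw [hr.natDegree] at h
    rw [h] at hc hne
    exact hne (coeff_eq_zero_of_eq_X_sub_C_pow hc)
  obtain ⟨q₁, q₂, hm₁, hm₂, hcop, hprod, hd₁, hd₂⟩ :=
    exists_coprime_factorization (hr.monic t₀) (mem_roots'.1 ha).2 hpow
  obtain ⟨Q, R, hQ, hR, -, -, hQR⟩ := hr.exists_factorization hm₁ hm₂ hcop hprod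
  rw [hr.natDegree] at hd₁ hd₂
  exact ⟨_, _, Q, R, hd₁, hd₂, by rw [← hm₁.natDegree_mul hm₂, ← hprod, hr.natDegree],
    hQ, hR, hQR⟩

theorem coeff_taylor_eq_zero {p : ℝ → ℝ[X]} (hp : AnalyticMonicFamily p (n + 1) t₀) (t : ℝ) :
    (Polynomial.taylor (-(p t).coeff n / (n + 1)) (p t)).coeff n = 0 := by
  rw [taylor_coeff_of_natDegree_eq (hp.monic t) (hp.natDegree t)]
  field_simp
  ring

/-- **Rellich's theorem**: the roots of a real-rooted family can be chosen analytic. Translate to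
make the roots sum to zero, rescale them by the largest power of `t - t₀` that divides all of them,
and split the resulting family, whose roots no longer coincide at `t₀`, into two factors. -/
theorem hasAnalyticRoots {p : ℝ → ℝ[X]} (hp : AnalyticMonicFamily p n t₀)
    (hs : ∀ᶠ t in 𝓝 t₀, (p t).Splits) : HasAnalyticRoots p n t₀ := by
  induction n using Nat.strong_induction_on generalizing p with
  | _ n ih =>
  match n with
  | 0 => exact hp.hasAnalyticRoots_zero
  | 1 => exact hp.hasAnalyticRoots_one
  | n + 2 =>
    let s : ℝ → ℝ := fun t => -(p t).coeff (n + 1) / ((n + 1 : ℕ) + 1)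
    have hsa : AnalyticAt ℝ s t₀ := (hp.analyticAt (n + 1)).neg.div_const
    let q : ℝ → ℝ[X] := fun t => Polynomial.taylor (s t) (p t)
    have hq : AnalyticMonicFamily q (n + 2) t₀ := hp.taylor hsa
    have hqs : ∀ᶠ t in 𝓝 t₀, (q t).Splits := hs.mono fun t ht => ht.taylor _
    have hqc : ∀ t, (q t).coeff (n + 1) = 0 := hp.coeff_taylor_eq_zero
    suffices hroots : HasAnalyticRoots q (n + 2) t₀ from
      (hroots.taylor hsa.neg).congr (Eventually.of_forall fun t => by simp [q, taylor_taylor])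
    by_cases hne : ∀ᶠ t in 𝓝 t₀, (q t).coeff n = 0
    · refine HasAnalyticRoots.X_pow.congr ?_
      filter_upwards [hne, hqs] with t ht hst
      exact eq_X_pow_of_splits hst (hq.monic t) (hq.natDegree t) (hqc t) ht
    obtain ⟨k, r, hr, hqr, hr₁, hr₂⟩ := hq.exists_eq_scaleRoots_of_centered hqs hqc hne
    have hrs := hr.eventually_splits_of_eq_scaleRoots hqs hqr
    obtain ⟨a, b, Q, R, ha, hb, hab, hQ, hR, hQR⟩ :=
      hr.exists_factorization_of_centered hrs.self_of_nhds hr₁ hr₂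
    have hsplit : ∀ᶠ t in 𝓝 t₀, (Q t).Splits ∧ (R t).Splits := by
      filter_upwards [hrs, hQR] with t hst ht
      rwa [ht, splits_mul (hQ.monic t).ne_zero (hR.monic t).ne_zero] at hst
    have hrr := (ih a ha hQ (hsplit.mono fun t h => h.1)).mul
      (ih b hb hR (hsplit.mono fun t h => h.2))
    rw [hab] at hrr
    exact ((hrr.congr hQR).scaleRoots ((analyticAt_id.sub analyticAt_const).pow k)).congr hqr

end AnalyticMonicFamily

end Rellich

section RootSums

open Polynomial

theorem roots_sum_eq_neg_coeff {K : Type*} [Field K] [IsAlgClosed K] {p : K[X]} {n : ℕ}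
    (hm : p.Monic) (hd : p.natDegree = n + 1) : p.roots.sum = -p.coeff n := by
  have h := (IsAlgClosed.splits p).nextCoeff_eq_neg_sum_roots_of_monic hm
  rw [nextCoeff, if_neg (by omega), hd, Nat.add_sub_cancel] at h
  rw [h, neg_neg]

/-- The sum of the roots of `p`, each taken with the sign `±1` of the side of the line
`Im (c z) = 0` it lies on; roots on the line are omitted. -/
noncomputable def signedRootSum (c : ℂ) (p : ℂ[X]) : ℂ :=
  (p.roots.map fun z => ((SignType.sign (c * z).im : ℝ) : ℂ) * z).sum

theorem signedRootSum_mul {c : ℂ} {p q : ℂ[X]} (h : p * q ≠ 0) :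
    signedRootSum c (p * q) = signedRootSum c p + signedRootSum c q := by
  rw [signedRootSum, roots_mul h, Multiset.map_add, Multiset.sum_add]
  rfl

theorem signedRootSum_eq_sum_roots {c : ℂ} {p : ℂ[X]}
    (h : ∀ z, p.IsRoot z → 0 < (c * z).im) : signedRootSum c p = p.roots.sum := by
  rw [signedRootSum, ← Multiset.map_id' p.roots, Multiset.map_map]
  refine congrArg Multiset.sum (Multiset.map_congr rfl fun z hz => ?_)
  simp [-Complex.mul_im, sign_pos (h z (mem_roots'.1 hz).2)]

theorem signedRootSum_eq_neg_sum_roots {c : ℂ} {p : ℂ[X]}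
    (h : ∀ z, p.IsRoot z → (c * z).im < 0) : signedRootSum c p = -p.roots.sum := by
  rw [signedRootSum, ← Multiset.sum_map_neg']
  refine congrArg Multiset.sum (Multiset.map_congr rfl fun z hz => ?_)
  simp [-Complex.mul_im, sign_neg (h z (mem_roots'.1 hz).2)]

theorem exists_factorization_of_im_ne_zero {c : ℂ} {p : ℂ[X]} (hm : p.Monic)
    (h : ∀ z, p.IsRoot z → (c * z).im ≠ 0) :
    ∃ q r : ℂ[X], q.Monic ∧ r.Monic ∧ p = q * r ∧
      (∀ z, q.IsRoot z → 0 < (c * z).im) ∧ ∀ z, r.IsRoot z → (c * z).im < 0 := by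
  classical
  have isRoot_iff (s : Multiset ℂ) (z : ℂ) :
      (s.map fun a => X - C a).prod.IsRoot z ↔ z ∈ s := by
    rw [← mem_roots (monic_multiset_prod_of_monic _ _ fun a _ => monic_X_sub_C a).ne_zero,
      roots_multiset_prod_X_sub_C]
  refine ⟨((p.roots.filter fun z => 0 < (c * z).im).map fun a => X - C a).prod,
    ((p.roots.filter fun z => ¬ 0 < (c * z).im).map fun a => X - C a).prod,
    monic_multiset_prod_of_monic _ _ fun a _ => monic_X_sub_C a,
    monic_multiset_prod_of_monic _ _ fun a _ => monic_X_sub_C a, ?_, fun z hz => ?_, fun z hz => ?_⟩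
  · conv_lhs => rw [(IsAlgClosed.splits p).eq_prod_roots_of_monic hm]
    rw [← Multiset.prod_add, ← Multiset.map_add, Multiset.filter_add_not]
  · exact (Multiset.mem_filter.1 ((isRoot_iff _ z).1 hz)).2
  · have hz' := Multiset.mem_filter.1 ((isRoot_iff _ z).1 hz)
    exact (not_lt.1 hz'.2).lt_of_ne (h z (mem_roots'.1 hz'.1).2)

namespace AnalyticMonicFamily

section Continuity

variable {𝕜 : Type*} [RCLike 𝕜] {p : 𝕜 → 𝕜[X]} {n : ℕ} {z₀ : 𝕜}

theorem eventually_norm_roots_le (hp : AnalyticMonicFamily p n z₀) :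
    ∃ M : ℝ, ∀ᶠ ζ in 𝓝 z₀, ∀ z, (p ζ).IsRoot z → ‖z‖ ≤ M := by
  let f : 𝕜 → NNReal := fun ζ => ∑ i ∈ Finset.range n, ‖(p ζ).coeff i‖₊
  have hf : ContinuousAt f z₀ :=
    tendsto_finsetSum _ fun i _ => (hp.analyticAt i).continuousAt.nnnorm
  refine ⟨((f z₀ + 1 : NNReal) : ℝ) + 1, ?_⟩
  filter_upwards [hf.eventually_lt continuousAt_const (lt_add_one (f z₀))] with ζ hζ z hz
  have hroot := hz.norm_lt_cauchyBound (hp.monic ζ).ne_zero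
  have hbound : cauchyBound (p ζ) ≤ f z₀ + 1 + 1 := by
    rw [cauchyBound, (hp.monic ζ).leadingCoeff, nnnorm_one, div_one, hp.natDegree]
    gcongr
    refine (Finset.sup_le fun i hi => ?_).trans hζ.le
    exact Finset.single_le_sum (f := fun i => ‖(p ζ).coeff i‖₊) (fun _ _ => zero_le) hi
  exact_mod_cast (hroot.trans_le hbound).le

theorem continuousAt_eval (hp : AnalyticMonicFamily p n z₀) (z : 𝕜) :
    ContinuousAt (fun y : 𝕜 × 𝕜 => (p y.1).eval y.2) (z₀, z) := by
  simp only [eval_eq_sum_range, hp.natDegree]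
  refine tendsto_finsetSum _ fun i _ => ContinuousAt.mul ?_ (continuousAt_snd.pow i)
  exact ContinuousAt.comp (f := Prod.fst) (x := (z₀, z)) (hp.analyticAt i).continuousAt
    continuousAt_fst

theorem eventually_roots_mem (hp : AnalyticMonicFamily p n z₀) {U : Set 𝕜} (hU : IsOpen U)
    (h : ∀ z, (p z₀).IsRoot z → z ∈ U) : ∀ᶠ ζ in 𝓝 z₀, ∀ z, (p ζ).IsRoot z → z ∈ U := by
  obtain ⟨M, hM⟩ := hp.eventually_norm_roots_le
  have hK : IsCompact (Metric.closedBall (0 : 𝕜) M \ U) := (isCompact_closedBall 0 M).diff hU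
  have hev : ∀ᶠ ζ in 𝓝 z₀, ∀ z ∈ Metric.closedBall (0 : 𝕜) M \ U, (p ζ).eval z ≠ 0 :=
    hK.eventually_forall_of_forall_eventually fun z hz =>
      (hp.continuousAt_eval z).eventually_ne fun h0 => hz.2 (h z h0)
  filter_upwards [hM, hev] with ζ hnorm hne z hz
  by_contra hzU
  exact hne z ⟨by simpa using hnorm z hz, hzU⟩ hz

end Continuity

variable {p : ℂ → ℂ[X]} {n : ℕ} {z₀ : ℂ}

theorem analyticAt_sum_roots (hp : AnalyticMonicFamily p n z₀) :
    AnalyticAt ℂ (fun ζ => (p ζ).roots.sum) z₀ := by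
  cases n with
  | zero =>
    have hroots (ζ : ℂ) : (p ζ).roots = 0 := by
      rw [(hp.monic ζ).natDegree_eq_zero.1 (hp.natDegree ζ), roots_one, Multiset.empty_eq_zero]
    simp only [hroots, Multiset.sum_zero]
    exact analyticAt_const
  | succ n =>
    simp only [roots_sum_eq_neg_coeff (hp.monic _) (hp.natDegree _)]
    exact (hp.analyticAt n).neg

theorem analyticAt_signedRootSum (hp : AnalyticMonicFamily p n z₀) (c : ℂ)
    (h : ∀ z, (p z₀).IsRoot z → (c * z).im ≠ 0) :
    AnalyticAt ℂ (fun ζ => signedRootSum c (p ζ)) z₀ := by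
  obtain ⟨q, r, hq, hr, hpqr, hqpos, hrneg⟩ := exists_factorization_of_im_ne_zero (hp.monic z₀) h
  have hcop : IsCoprime q r := by
    rw [Polynomial.isCoprime_iff_aeval_ne_zero_of_isAlgClosed ℂ ℂ]
    intro z
    by_contra! hz
    exact lt_asymm (hqpos z (by simpa using hz.1)) (hrneg z (by simpa using hz.2))
  obtain ⟨Q, R, hQ, hR, hQ0, hR0, hQR⟩ := hp.exists_factorization hq hr hcop hpqr
  have hcont : Continuous fun z : ℂ => (c * z).im := by fun_prop
  have hQpos := hQ.eventually_roots_mem (U := {z | 0 < (c * z).im})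
    (isOpen_lt continuous_const hcont) (fun z hz => hqpos z (hQ0 ▸ hz))
  have hRneg := hR.eventually_roots_mem (U := {z | (c * z).im < 0})
    (isOpen_lt hcont continuous_const) (fun z hz => hrneg z (hR0 ▸ hz))
  refine (hQ.analyticAt_sum_roots.sub hR.analyticAt_sum_roots).congr ?_
  filter_upwards [hQR, hQpos, hRneg] with ζ hmul hpos hneg
  rw [hmul, signedRootSum_mul (mul_ne_zero (hQ.monic ζ).ne_zero (hR.monic ζ).ne_zero),
    signedRootSum_eq_sum_roots hpos, signedRootSum_eq_neg_sum_roots hneg, Pi.sub_apply,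
    sub_eq_add_neg]

end AnalyticMonicFamily

end RootSums

section UpperHalfPlane

open Complex Polynomial

theorem abs_im_le_of_lipschitzOnWith {f : ℂ → ℂ} {K : NNReal} {s : Set ℂ}
    (hf : LipschitzOnWith K f s) {w : ℂ} (hw : w ∈ s) (hre : (w.re : ℂ) ∈ s)
    (hreal : (f w.re).im = 0) : |(f w).im| ≤ K * |w.im| := by
  have hdist : dist w (w.re : ℂ) = |w.im| := by
    rw [dist_eq_norm, show w - w.re = w.im * I by linear_combination -(re_add_im w)]
    simp
  calc |(f w).im| = |(f w - f w.re).im| := by rw [sub_im, hreal, sub_zero]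
    _ ≤ dist (f w) (f w.re) := dist_eq_norm (f w) _ ▸ abs_im_le_norm _
    _ ≤ K * |w.im| := hdist ▸ hf.dist_le_mul w hw _ hre

theorem exists_eventually_abs_im_le {g : ℂ → ℂ} (hg : AnalyticAt ℂ g 0)
    (hreal : ∀ᶠ x : ℝ in 𝓝 0, (g x).im = 0) :
    ∃ K : ℝ, ∀ᶠ w in 𝓝 (0 : ℂ), |(g w).im| ≤ K * |w.im| := by
  obtain ⟨K, s, hs, hK⟩ := (hg.contDiffAt (n := 1)).exists_lipschitzOnWith
  have hre : Tendsto re (𝓝 (0 : ℂ)) (𝓝 0) := continuous_re.tendsto 0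
  have hreC : Tendsto (fun w : ℂ => (w.re : ℂ)) (𝓝 0) (𝓝 0) := by
    have : Continuous fun w : ℂ => (w.re : ℂ) := by fun_prop
    simpa using this.tendsto 0
  refine ⟨K, ?_⟩
  filter_upwards [hs, hreC hs, hre.eventually hreal] with w hw hw' hw0
  exact abs_im_le_of_lipschitzOnWith hK hw hw' hw0

theorem exists_abs_im_aeval_le (P : ℝ[X]) (R : ℝ) :
    ∃ K : NNReal, ∀ u : ℂ, ‖u‖ ≤ R → |(aeval u P).im| ≤ K * |u.im| := by
  have hdiff : ContDiff ℝ 1 fun u : ℂ => aeval u P := by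
    simp only [aeval_eq_sum_range]
    fun_prop
  obtain ⟨K, hK⟩ := hdiff.contDiffOn.exists_lipschitzOnWith one_ne_zero
    (convex_closedBall (0 : ℂ) R) (isCompact_closedBall 0 R)
  refine ⟨K, fun u hu => abs_im_le_of_lipschitzOnWith hK (by simpa using hu) ?_ ?_⟩
  · simpa using (abs_re_le_norm u).trans hu
  · rw [← coe_algebraMap, aeval_algebraMap_apply, coe_algebraMap, ofReal_im]

theorem abs_im_inv_le {w : ℂ} {δ : ℝ} (hδ : 0 < δ) (hw : δ ≤ ‖w‖) :
    |w⁻¹.im| ≤ (δ ^ 2)⁻¹ * |w.im| := by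
  rw [inv_im, abs_div, abs_neg, abs_of_nonneg (normSq_nonneg w), div_eq_inv_mul,
    normSq_eq_norm_sq]
  gcongr

/-- Phragmén–Lindelöf for `exp (i N)`, whose modulus is `exp (-Im N)`. -/
theorem le_im_of_le_im_boundary {N : ℂ → ℂ} {ε M b : ℝ}
    (hd : ∀ w : ℂ, ε ≤ w.im → DifferentiableAt ℂ N w) (hM : ∀ w : ℂ, ε ≤ w.im → ‖N w‖ ≤ M)
    (hb : ∀ w : ℂ, w.im = ε → b ≤ (N w).im) {w : ℂ} (hw : ε ≤ w.im) : b ≤ (N w).im := by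
  let f : ℂ → ℂ := fun z => exp (I * N (I * z + I * ε))
  have him (z : ℂ) : (I * z + I * ε).im = z.re + ε := by simp
  have hnorm (z : ℂ) : ‖f z‖ = Real.exp (-(N (I * z + I * ε)).im) := by simp [f, norm_exp]
  have hbd (z : ℂ) (hz : 0 ≤ z.re) : ‖f z‖ ≤ Real.exp M := by
    rw [hnorm, Real.exp_le_exp]
    exact (neg_le_abs _).trans ((abs_im_le_norm _).trans (hM _ (by rw [him]; linarith)))
  have hdiff : DiffContOnCl ℂ f {z | 0 < z.re} := by
    refine DifferentiableOn.diffContOnCl fun z hz => ?_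
    rw [closure_setOfPred_lt_re] at hz
    have hz' : ε ≤ (I * z + I * ε).im := by
      rw [him]
      exact le_add_of_nonneg_left hz
    have hcomp : DifferentiableAt ℂ (fun z : ℂ => N (I * z + I * ε)) z :=
      (hd _ hz').comp z (by fun_prop)
    exact (hcomp.const_mul I).cexp.differentiableWithinAt
  have hgrowth : f =O[Bornology.cobounded ℂ ⊓ 𝓟 {z | 0 < z.re}]
      fun z => Real.exp (0 * ‖z‖ ^ (1 : ℝ)) := by
    refine Asymptotics.IsBigO.of_bound (Real.exp M) ?_
    rw [eventually_inf_principal]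
    exact Eventually.of_forall fun z hz => by simpa using hbd z (le_of_lt hz)
  have key := PhragmenLindelof.right_half_plane_of_bounded_on_real (f := f) (C := Real.exp (-b))
    (z := -I * w - ε) hdiff ⟨1, one_lt_two, 0, hgrowth⟩
    (isBoundedUnder_of_eventually_le (a := Real.exp M) ?_) (fun x => ?_) (by simpa using hw)
  · rw [hnorm, Real.exp_le_exp, show I * (-I * w - ε) + I * ε = w by
      linear_combination (-w) * I_sq] at key
    linarith
  · filter_upwards [eventually_ge_atTop 0] with x hx
    exact hbd x (by simpa using hx)
  · rw [hnorm, Real.exp_le_exp]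
    exact neg_le_neg (hb _ (by rw [him]; simp))

theorem im_nonneg_of_eventually_le_im {N : ℂ → ℂ} {B : ℝ}
    (hd : ∀ w : ℂ, 0 < w.im → DifferentiableAt ℂ N w)
    (hM : ∀ ε > 0, ∃ M, ∀ w : ℂ, ε ≤ w.im → ‖N w‖ ≤ M)
    (hb : ∀ᶠ ε in 𝓝[>] 0, ∀ w : ℂ, w.im = ε → -(B * ε) ≤ (N w).im) {w : ℂ} (hw : 0 < w.im) :
    0 ≤ (N w).im := by
  have hlim : Tendsto (fun ε : ℝ => -(B * ε)) (𝓝[>] 0) (𝓝 0) := by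
    have : ContinuousAt (fun ε : ℝ => -(B * ε)) 0 := by fun_prop
    simpa using this.tendsto.mono_left nhdsWithin_le_nhds
  have hsmall : ∀ᶠ ε in 𝓝[>] 0, ε < w.im := (eventually_lt_nhds hw).filter_mono nhdsWithin_le_nhds
  refine le_of_tendsto hlim ?_
  filter_upwards [self_mem_nhdsWithin, hsmall, hb] with ε hε hεw hbε
  obtain ⟨M, hM⟩ := hM ε hε
  exact le_im_of_le_im_boundary (fun z hz => hd z (lt_of_lt_of_le hε hz)) hM hbε hεw.le

theorem deriv_re_nonpos_of_im_nonpos {g : ℂ → ℂ} (hg : DifferentiableAt ℂ g 0)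
    (hg0 : (g 0).im = 0) (hneg : ∀ᶠ w in 𝓝 (0 : ℂ), 0 < w.im → (g w).im ≤ 0) :
    (deriv g 0).re ≤ 0 := by
  have htend : Tendsto (fun y : ℝ => (y : ℂ) * I) (𝓝[>] 0) (𝓝 0) := by
    have : ContinuousAt (fun y : ℝ => (y : ℂ) * I) 0 := by fun_prop
    simpa using this.tendsto.mono_left nhdsWithin_le_nhds
  have hpath : Tendsto (fun y : ℝ => (y : ℂ) * I) (𝓝[>] 0) (𝓝[≠] 0) := by
    refine tendsto_nhdsWithin_iff.2 ⟨htend, ?_⟩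
    filter_upwards [self_mem_nhdsWithin] with y hy
    simpa using (ne_of_gt hy : y ≠ 0)
  have hslope := (continuous_re.tendsto _).comp
    ((hasDerivAt_iff_tendsto_slope.1 hg.hasDerivAt).comp hpath)
  refine le_of_tendsto hslope ?_
  filter_upwards [self_mem_nhdsWithin, htend.eventually hneg] with y (hy : 0 < y) hgy
  have hrot : (g (y * I) - g 0) / (y * I) = -(I * (g (y * I) - g 0)) / y := by
    have : (y : ℂ) ≠ 0 := by exact_mod_cast hy.ne'
    field_simp
    linear_combination (g (y * I) - g 0) * I_sq
  simp only [Function.comp, slope_def_field, sub_zero]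
  rw [hrot, div_ofReal_re]
  refine div_nonpos_of_nonpos_of_nonneg ?_ hy.le
  simpa [hg0] using hgy (by simpa using hy)

theorem exists_le_im_mul_inv_sq_add_aeval {F : ℂ → ℂ} {δ : ℝ} (hδ : 0 < δ) {M : ℝ}
    (hpos : ∀ w : ℂ, 0 < w.im → 0 ≤ (F w).im)
    (hM : ∀ w : ℂ, 0 < w.im → δ ≤ ‖w‖ → ‖F w‖ ≤ M) (P : ℝ[X]) :
    ∃ K : ℝ, ∀ w : ℂ, 0 < w.im → w.im < δ / 2 → δ ≤ ‖w‖ →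
      -(K * w.im) ≤ (F w * w⁻¹ ^ 2 + aeval w⁻¹ P).im := by
  obtain ⟨K₁, hK₁⟩ := exists_abs_im_aeval_le (X ^ 2) δ⁻¹
  obtain ⟨K₂, hK₂⟩ := exists_abs_im_aeval_le P δ⁻¹
  refine ⟨M * (K₁ * (δ ^ 2)⁻¹) + K₂ * (δ ^ 2)⁻¹, fun w hw hwδ hwn => ?_⟩
  have hu : ‖w⁻¹‖ ≤ δ⁻¹ := by
    rw [norm_inv]
    exact inv_anti₀ hδ hwn
  have huim := abs_im_inv_le hδ hwn
  rw [abs_of_pos hw] at huim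
  have hsq : |(w⁻¹ ^ 2).im| ≤ K₁ * (δ ^ 2)⁻¹ * w.im := by
    have := hK₁ _ hu
    rw [map_pow, aeval_X] at this
    exact this.trans (by rw [mul_assoc]; gcongr)
  have hP : |(aeval w⁻¹ P).im| ≤ K₂ * (δ ^ 2)⁻¹ * w.im :=
    (hK₂ _ hu).trans (by rw [mul_assoc]; gcongr)
  have hre : 0 ≤ (w⁻¹ ^ 2).re := by
    have hnormSq : w.re ^ 2 + w.im ^ 2 = ‖w‖ ^ 2 := by
      rw [← normSq_eq_norm_sq, normSq_apply]
      ring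
    rw [inv_pow, inv_re]
    refine div_nonneg ?_ (normSq_nonneg _)
    rw [sq, mul_re]
    nlinarith
  have hcross : |(F w).re * (w⁻¹ ^ 2).im| ≤ M * (K₁ * (δ ^ 2)⁻¹ * w.im) := by
    rw [abs_mul]
    have hFM := hM w hw hwn
    exact mul_le_mul ((abs_re_le_norm _).trans hFM) hsq (abs_nonneg _) ((norm_nonneg _).trans hFM)
  rw [add_im, mul_im]
  linarith [neg_abs_le ((F w).re * (w⁻¹ ^ 2).im), mul_nonneg (hpos w hw) hre,
    neg_abs_le (aeval w⁻¹ P).im]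

theorem exists_norm_mul_inv_sq_add_aeval_le {F : ℂ → ℂ}
    (hbdd : ∀ δ > 0, ∃ M, ∀ w : ℂ, 0 < w.im → δ ≤ ‖w‖ → ‖F w‖ ≤ M) (P : ℝ[X]) {ε : ℝ}
    (hε : 0 < ε) : ∃ M, ∀ w : ℂ, ε ≤ w.im → ‖F w * w⁻¹ ^ 2 + aeval w⁻¹ P‖ ≤ M := by
  obtain ⟨M₁, hM₁⟩ := hbdd ε hε
  obtain ⟨M₂, hM₂⟩ := (isCompact_closedBall (0 : ℂ) ε⁻¹).exists_bound_of_continuousOn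
    (P.continuous_aeval (A := ℂ)).continuousOn
  refine ⟨M₁ * ε⁻¹ ^ 2 + M₂, fun w hw => ?_⟩
  have hwn : ε ≤ ‖w‖ := hw.trans ((le_abs_self _).trans (abs_im_le_norm w))
  have hu : ‖w⁻¹‖ ≤ ε⁻¹ := by
    rw [norm_inv]
    exact inv_anti₀ hε hwn
  have hFM := hM₁ w (hε.trans_le hw) hwn
  refine (norm_add_le _ _).trans (add_le_add ?_ (hM₂ _ (by simpa using hu)))
  rw [norm_mul, norm_pow]
  exact mul_le_mul hFM (by gcongr) (by positivity) ((norm_nonneg _).trans hFM)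

/-- `P(1 / w)` is the polar part of `-F(w) / w²` at the origin and `-g` its analytic part. The
difference has non-negative imaginary part on the whole half-plane, since on horizontal lines close
to the real axis this holds up to a multiple of the height. -/
theorem deriv_re_nonpos_of_pick {F g : ℂ → ℂ}
    (hF : ∀ w : ℂ, 0 < w.im → DifferentiableAt ℂ F w) (hpos : ∀ w : ℂ, 0 < w.im → 0 ≤ (F w).im)
    (hbdd : ∀ δ > 0, ∃ M, ∀ w : ℂ, 0 < w.im → δ ≤ ‖w‖ → ‖F w‖ ≤ M) (hg : AnalyticAt ℂ g 0)
    (hreal : ∀ᶠ x : ℝ in 𝓝 0, (g x).im = 0) {P : ℝ[X]}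
    (hFg : ∀ᶠ w in 𝓝 (0 : ℂ), 0 < w.im → F w * w⁻¹ ^ 2 + aeval w⁻¹ P = -g w) :
    (deriv g 0).re ≤ 0 := by
  obtain ⟨K₁, hK₁⟩ := exists_eventually_abs_im_le hg hreal
  obtain ⟨δ, hδ, hnear⟩ := Metric.eventually_nhds_iff.1 (hFg.and hK₁)
  obtain ⟨M, hM⟩ := hbdd δ hδ
  obtain ⟨K₂, hK₂⟩ := exists_le_im_mul_inv_sq_add_aeval hδ hpos hM P
  have hd (w : ℂ) (hw : 0 < w.im) :
      DifferentiableAt ℂ (fun w => F w * w⁻¹ ^ 2 + aeval w⁻¹ P) w := by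
    have hw0 : w ≠ 0 := fun h => by simp [h] at hw
    exact ((hF w hw).mul ((differentiableAt_inv hw0).pow 2)).add
      ((P.differentiable_aeval _).comp w (differentiableAt_inv hw0))
  have hline : ∀ᶠ ε in 𝓝[>] (0 : ℝ), ∀ w : ℂ, w.im = ε →
      -(max K₁ K₂ * ε) ≤ (F w * w⁻¹ ^ 2 + aeval w⁻¹ P).im := by
    filter_upwards [Ioo_mem_nhdsGT (half_pos hδ)] with ε hε w hw
    subst hw
    rcases lt_or_ge ‖w‖ δ with hwδ | hwδ
    · obtain ⟨heq, hle⟩ := hnear (y := w) (by rwa [dist_zero_right])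
      rw [heq hε.1, neg_im, neg_le_neg_iff]
      rw [abs_of_pos hε.1] at hle
      exact (le_abs_self _).trans (hle.trans (by gcongr; exacts [hε.1.le, le_max_left _ _]))
    · refine le_trans (neg_le_neg ?_) (hK₂ w hε.1 hε.2 hwδ)
      gcongr
      exacts [hε.1.le, le_max_right _ _]
  refine deriv_re_nonpos_of_im_nonpos hg.differentiableAt (by simpa using hreal.self_of_nhds) ?_
  filter_upwards [hFg] with w hw him
  have := im_nonneg_of_eventually_le_im hd
    (fun ε hε => exists_norm_mul_inv_sq_add_aeval_le hbdd P hε) hline him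
  rw [hw him, neg_im] at this
  linarith

end UpperHalfPlane

section TaylorCoefficients

variable {𝕜 : Type*} [RCLike 𝕜]

/-- The coefficient of `tⁿ` in the Taylor expansion of `f` at the origin. -/
noncomputable def taylorCoeff (n : ℕ) (f : 𝕜 → 𝕜) : 𝕜 :=
  iteratedDeriv n f 0 / n.factorial

variable {f g : 𝕜 → 𝕜}

theorem iteratedDeriv_zero_eq_factorial_mul (n : ℕ) (f : 𝕜 → 𝕜) :
    iteratedDeriv n f 0 = n.factorial * taylorCoeff n f := by
  rw [taylorCoeff, mul_div_cancel₀ _ (Nat.cast_ne_zero.2 n.factorial_ne_zero)]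

theorem taylorCoeff_zero (f : 𝕜 → 𝕜) : taylorCoeff 0 f = f 0 := by
  simp [taylorCoeff]

theorem taylorCoeff_one (f : 𝕜 → 𝕜) : taylorCoeff 1 f = deriv f 0 := by
  simp [taylorCoeff, iteratedDeriv_one]

theorem taylorCoeff_congr (n : ℕ) (h : f =ᶠ[𝓝 0] g) : taylorCoeff n f = taylorCoeff n g := by
  rw [taylorCoeff, taylorCoeff, h.iteratedDeriv_eq]

theorem taylorCoeff_add (n : ℕ) (hf : AnalyticAt 𝕜 f 0) (hg : AnalyticAt 𝕜 g 0) :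
    taylorCoeff n (fun t => f t + g t) = taylorCoeff n f + taylorCoeff n g := by
  simp only [taylorCoeff, ← add_div]
  exact congrArg (· / (n.factorial : 𝕜)) (iteratedDeriv_fun_add hf.contDiffAt hg.contDiffAt)

theorem taylorCoeff_sum {ι : Type*} (s : Finset ι) (n : ℕ) {f : ι → 𝕜 → 𝕜}
    (hf : ∀ i ∈ s, AnalyticAt 𝕜 (f i) 0) :
    taylorCoeff n (fun t => ∑ i ∈ s, f i t) = ∑ i ∈ s, taylorCoeff n (f i) := by
  simp only [taylorCoeff, ← Finset.sum_div]
  rw [iteratedDeriv_fun_sum fun i hi => (hf i hi).contDiffAt]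

theorem taylorCoeff_const_mul (n : ℕ) (c : 𝕜) (f : 𝕜 → 𝕜) :
    taylorCoeff n (fun t => c * f t) = c * taylorCoeff n f := by
  rw [taylorCoeff, iteratedDeriv_const_mul_field, taylorCoeff, mul_div_assoc]

theorem taylorCoeff_deriv (n : ℕ) (f : 𝕜 → 𝕜) :
    taylorCoeff n (deriv f) = (n + 1) * taylorCoeff (n + 1) f := by
  have : (n : 𝕜) + 1 ≠ 0 := Nat.cast_add_one_ne_zero n
  have : (n.factorial : 𝕜) ≠ 0 := Nat.cast_ne_zero.2 n.factorial_ne_zero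
  rw [taylorCoeff, taylorCoeff, iteratedDeriv_succ', Nat.factorial_succ]
  push_cast
  field_simp

theorem succ_mul_taylorCoeff_succ_id_mul (n : ℕ) (hf : AnalyticAt 𝕜 f 0) :
    (n + 1) * taylorCoeff (n + 1) (fun t => t * f t) =
      taylorCoeff n f + taylorCoeff n (fun t => t * deriv f t) := by
  have hderiv : deriv (fun t => t * f t) =ᶠ[𝓝 0] fun t => f t + t * deriv f t := by
    filter_upwards [hf.eventually_analyticAt] with t ht
    rw [deriv_fun_mul differentiableAt_fun_id ht.differentiableAt, deriv_id'', one_mul]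
  have hid : AnalyticAt 𝕜 (fun t : 𝕜 => t) 0 := analyticAt_id
  rw [← taylorCoeff_deriv, taylorCoeff_congr n hderiv,
    taylorCoeff_add n hf (hid.fun_mul hf.deriv)]

theorem taylorCoeff_succ_id_mul (n : ℕ) (hf : AnalyticAt 𝕜 f 0) :
    taylorCoeff (n + 1) (fun t => t * f t) = taylorCoeff n f := by
  induction n generalizing f with
  | zero => simpa [taylorCoeff_zero] using succ_mul_taylorCoeff_succ_id_mul 0 hf
  | succ n ih =>
    have h := succ_mul_taylorCoeff_succ_id_mul (n + 1) hf
    rw [ih hf.deriv, taylorCoeff_deriv] at h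
    refine mul_left_cancel₀ (Nat.cast_add_one_ne_zero (n + 1)) (h.trans ?_)
    push_cast
    ring

theorem taylorCoeff_add_pow_mul (n m : ℕ) (hf : AnalyticAt 𝕜 f 0) :
    taylorCoeff (n + m) (fun t => t ^ m * f t) = taylorCoeff n f := by
  induction m with
  | zero => simp
  | succ m ih =>
    simp only [pow_succ', mul_assoc]
    rw [← add_assoc, taylorCoeff_succ_id_mul _ (by fun_prop), ih]

theorem taylorCoeff_pow_of_lt {k n : ℕ} (h : k < n) : taylorCoeff n (fun t : 𝕜 => t ^ k) = 0 := by
  obtain ⟨j, rfl⟩ := Nat.exists_eq_add_of_lt h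
  have hone : taylorCoeff (j + 1) (fun _ : 𝕜 => 1) = 0 := by simp [taylorCoeff, iteratedDeriv_const]
  rw [show k + j + 1 = j + 1 + k by ring, ← hone,
    ← taylorCoeff_add_pow_mul (j + 1) k (analyticAt_const (v := (1 : 𝕜)))]
  simp only [mul_one]

theorem exists_eq_sum_taylorCoeff_add (hf : AnalyticAt 𝕜 f 0) (n : ℕ) :
    ∃ g : 𝕜 → 𝕜, AnalyticAt 𝕜 g 0 ∧ (∀ m, taylorCoeff m g = taylorCoeff (m + n) f) ∧
      ∀ z, f z = (∑ k ∈ Finset.range n, taylorCoeff k f * z ^ k) + z ^ n * g z := by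
  obtain ⟨g, hg, hfg⟩ := hf.exists_eq_sum_add_pow_mul n
  replace hfg (z : 𝕜) :
      f z = (∑ k ∈ Finset.range n, taylorCoeff k f * z ^ k) + z ^ n * g z := by
    rw [hfg z, smul_eq_mul, add_left_inj]
    exact Finset.sum_congr rfl fun k _ => by rw [smul_eq_mul, taylorCoeff]; ring
  have hterm (k : ℕ) : AnalyticAt 𝕜 (fun z => taylorCoeff k f * z ^ k) 0 := by fun_prop
  refine ⟨g, hg, fun m => ?_, hfg⟩
  conv_rhs => rw [funext hfg]
  rw [taylorCoeff_add _ (Finset.analyticAt_fun_sum _ fun k _ => hterm k) (by fun_prop),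
    taylorCoeff_sum _ _ fun k _ => hterm k, taylorCoeff_add_pow_mul m n hg]
  refine (add_eq_right.2 (Finset.sum_eq_zero fun k hk => ?_)).symm
  rw [taylorCoeff_const_mul, taylorCoeff_pow_of_lt (by grind), mul_zero]

section LagrangeInversion

variable {s v : 𝕜 → 𝕜}

theorem taylorCoeff_pow_mul_deriv_div_pow (hs : AnalyticAt 𝕜 s 0) (hs0 : s 0 ≠ 0) {N k : ℕ}
    (hk : k ≤ N) :
    taylorCoeff N (fun t => s t ^ (N + 1) * deriv (fun t => (t / s t) ^ k) t) = 0 := by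
  obtain ⟨m, rfl⟩ := Nat.exists_eq_add_of_le hk
  cases k with
  | zero => simpa using taylorCoeff_const_mul (0 + m) 0 s
  | succ j =>
    have hm : (m : 𝕜) + 1 ≠ 0 := Nat.cast_add_one_ne_zero m
    have hpow : AnalyticAt 𝕜 (fun t => s t ^ (m + 1)) 0 := hs.fun_pow _
    have hexp : (fun t => s t ^ (j + 1 + m + 1) * deriv (fun t => (t / s t) ^ (j + 1)) t) =ᶠ[𝓝 0]
        fun t => (j + 1) * (t ^ j * s t ^ (m + 1)) +
          -((j + 1) / (m + 1)) * (t ^ (j + 1) * deriv (fun t => s t ^ (m + 1)) t) := by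
      filter_upwards [hs.eventually_analyticAt, hs.continuousAt.eventually_ne hs0] with t ht hst
      have hquot := ((hasDerivAt_id t).fun_div ht.differentiableAt.hasDerivAt hst).fun_pow (j + 1)
      have hpow := ht.differentiableAt.hasDerivAt.fun_pow (m + 1)
      simp only [id] at hquot
      rw [hquot.deriv, hpow.deriv]
      push_cast
      simp only [div_pow]
      field_simp
      ring
    have hid : AnalyticAt 𝕜 (fun t : 𝕜 => t ^ (j + 1)) 0 := by fun_prop
    have hleft : AnalyticAt 𝕜 (fun t => ((j : 𝕜) + 1) * (t ^ j * s t ^ (m + 1))) 0 := by fun_prop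
    rw [taylorCoeff_congr _ hexp,
      taylorCoeff_add _ hleft (analyticAt_const.fun_mul (hid.fun_mul hpow.deriv)),
      taylorCoeff_const_mul, taylorCoeff_const_mul, show j + 1 + m = m + 1 + j by ring,
      taylorCoeff_add_pow_mul _ _ hpow, show m + 1 + j = m + (j + 1) by ring,
      taylorCoeff_add_pow_mul _ _ hpow.deriv, taylorCoeff_deriv]
    field_simp
    ring

theorem taylorCoeff_mul_deriv_pow_mul (hf : AnalyticAt 𝕜 f 0) (hg : AnalyticAt 𝕜 g 0) (N : ℕ) :
    taylorCoeff N (fun t => f t * deriv (fun t => t ^ (N + 1) * g t) t) =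
      (N + 1) * (f 0 * g 0) := by
  have hexp : (fun t => f t * deriv (fun t => t ^ (N + 1) * g t) t) =ᶠ[𝓝 0]
      fun t => t ^ N * (f t * ((N + 1) * g t + t * deriv g t)) := by
    filter_upwards [hg.eventually_analyticAt] with t ht
    rw [((hasDerivAt_pow (N + 1) t).fun_mul ht.differentiableAt.hasDerivAt).deriv]
    push_cast
    ring
  have hcof : AnalyticAt 𝕜 (fun t => f t * ((N + 1) * g t + t * deriv g t)) 0 :=
    hf.fun_mul (.fun_add (by fun_prop) (analyticAt_id.fun_mul hg.deriv))
  have hzero := taylorCoeff_add_pow_mul 0 N hcof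
  rw [Nat.zero_add, taylorCoeff_zero, zero_mul, add_zero] at hzero
  rw [taylorCoeff_congr _ hexp, hzero]
  ring

theorem taylorCoeff_mul_deriv_add {h : 𝕜 → 𝕜} (hh : AnalyticAt 𝕜 h 0) (hf : AnalyticAt 𝕜 f 0)
    (hg : AnalyticAt 𝕜 g 0) (N : ℕ) :
    taylorCoeff N (fun t => h t * deriv (fun t => f t + g t) t) =
      taylorCoeff N (fun t => h t * deriv f t) + taylorCoeff N (fun t => h t * deriv g t) := by
  rw [← taylorCoeff_add _ (hh.fun_mul hf.deriv) (hh.fun_mul hg.deriv)]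
  refine taylorCoeff_congr _ ?_
  filter_upwards [hf.eventually_analyticAt, hg.eventually_analyticAt] with t hft hgt
  rw [deriv_fun_add hft.differentiableAt hgt.differentiableAt, mul_add]

theorem taylorCoeff_mul_deriv_sum {h : 𝕜 → 𝕜} (hh : AnalyticAt 𝕜 h 0) {ι : Type*} (I : Finset ι)
    (c : ι → 𝕜) {f : ι → 𝕜 → 𝕜} (hf : ∀ i ∈ I, AnalyticAt 𝕜 (f i) 0) (N : ℕ) :
    taylorCoeff N (fun t => h t * deriv (fun t => ∑ i ∈ I, c i * f i t) t) =
      ∑ i ∈ I, c i * taylorCoeff N (fun t => h t * deriv (f i) t) := by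
  simp only [← taylorCoeff_const_mul]
  rw [← taylorCoeff_sum _ _ fun i hi => analyticAt_const.fun_mul (hh.fun_mul (hf i hi).deriv)]
  refine taylorCoeff_congr _ ?_
  filter_upwards [(Filter.eventually_all_finset I).2 fun i hi => (hf i hi).eventually_analyticAt]
    with t ht
  rw [deriv_fun_sum fun i hi => (ht i hi).differentiableAt.const_mul (c i), Finset.mul_sum]
  simp only [deriv_const_mul_field, mul_left_comm]

/-- Lagrange–Bürmann inversion, checked on each term of the Taylor expansion of `v`. -/
theorem taylorCoeff_pow_mul_deriv_comp_div (hs : AnalyticAt 𝕜 s 0) (hs0 : s 0 ≠ 0)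
    (hv : AnalyticAt 𝕜 v 0) (N : ℕ) :
    taylorCoeff N (fun t => s t ^ (N + 1) * deriv (fun t => v (t / s t)) t) =
      (N + 1) * taylorCoeff (N + 1) v := by
  obtain ⟨g, hg, hcoeff, hexp⟩ := exists_eq_sum_taylorCoeff_add hv (N + 1)
  have hquot : AnalyticAt 𝕜 (fun t => t / s t) 0 := analyticAt_id.div hs hs0
  have hpow : AnalyticAt 𝕜 (fun t => s t ^ (N + 1)) 0 := hs.fun_pow _
  have hcomp : AnalyticAt 𝕜 (fun t => (s t ^ (N + 1))⁻¹ * g (t / s t)) 0 :=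
    (hpow.inv (pow_ne_zero _ hs0)).fun_mul (AnalyticAt.fun_comp (by simpa using hg) hquot)
  have hterm (k : ℕ) : AnalyticAt 𝕜 (fun t => (t / s t) ^ k) 0 := hquot.fun_pow k
  have hsplit : (fun t => v (t / s t)) = fun t =>
      (∑ k ∈ Finset.range (N + 1), taylorCoeff k v * (t / s t) ^ k) +
        t ^ (N + 1) * ((s t ^ (N + 1))⁻¹ * g (t / s t)) := by
    funext t
    rw [hexp (t / s t), div_pow t (s t) (N + 1)]
    ring
  have hlow : ∑ k ∈ Finset.range (N + 1), taylorCoeff k v *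
      taylorCoeff N (fun t => s t ^ (N + 1) * deriv (fun t => (t / s t) ^ k) t) = 0 := by
    refine Finset.sum_eq_zero fun k hk => ?_
    rw [taylorCoeff_pow_mul_deriv_div_pow hs hs0 (by grind), mul_zero]
  rw [hsplit, taylorCoeff_mul_deriv_add hpow
    (Finset.analyticAt_fun_sum _ fun k _ => analyticAt_const.fun_mul (hterm k)) (by fun_prop),
    taylorCoeff_mul_deriv_sum hpow _ _ fun k _ => hterm k, hlow, zero_add,
    taylorCoeff_mul_deriv_pow_mul hpow hcomp, zero_div,
    mul_inv_cancel_left₀ (pow_ne_zero _ hs0), ← taylorCoeff_zero g, hcoeff, Nat.zero_add]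

theorem taylorCoeff_eq_neg_div_of_comp_div_eq_inv (hs : AnalyticAt 𝕜 s 0) (hs0 : s 0 ≠ 0)
    (hv : AnalyticAt 𝕜 v 0) (h : ∀ᶠ t in 𝓝 0, v (t / s t) = (s t)⁻¹) (N : ℕ) :
    taylorCoeff (N + 2) v = -taylorCoeff (N + 2) (fun t => s t ^ (N + 1)) / (N + 1) := by
  have hN : (N : 𝕜) + 1 ≠ 0 := Nat.cast_add_one_ne_zero N
  have hexp : (fun t => s t ^ (N + 2) * deriv (fun t => v (t / s t)) t) =ᶠ[𝓝 0]
      fun t => -(1 / (N + 1)) * deriv (fun t => s t ^ (N + 1)) t := by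
    filter_upwards [hs.eventually_analyticAt, hs.continuousAt.eventually_ne hs0,
      h.eventually_nhds] with t ht hst hvt
    have hder := ht.differentiableAt.hasDerivAt
    rw [EventuallyEq.deriv_eq hvt, (hder.fun_inv hst).deriv, (hder.fun_pow (N + 1)).deriv]
    push_cast
    field_simp
    ring
  have hinv := taylorCoeff_pow_mul_deriv_comp_div hs hs0 hv (N + 1)
  rw [taylorCoeff_congr _ hexp, taylorCoeff_const_mul, taylorCoeff_deriv] at hinv
  push_cast at hinv
  field_simp at hinv ⊢
  linear_combination -hinv

end LagrangeInversion

end TaylorCoefficients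

section PickTaylor

open Polynomial

theorem iteratedDeriv_eq_ofReal_of_eventuallyEq {h : ℂ → ℂ} {η : ℝ → ℝ} {x : ℝ}
    (hh : AnalyticAt ℂ h x) (hη : AnalyticAt ℝ η x) (heq : ∀ᶠ y : ℝ in 𝓝 x, h y = η y) (n : ℕ) :
    iteratedDeriv n h x = iteratedDeriv n η x := by
  induction n generalizing h η with
  | zero => simpa using heq.self_of_nhds
  | succ n ih =>
    rw [iteratedDeriv_succ', iteratedDeriv_succ']
    refine ih hh.deriv hη.deriv ?_
    filter_upwards [heq.eventually_nhds, hη.eventually_analyticAt,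
      Complex.continuous_ofReal.continuousAt.eventually hh.eventually_analyticAt] with y hy hηy hhy
    exact (hhy.differentiableAt.hasDerivAt.comp_ofReal.congr_of_eventuallyEq
      (EventuallyEq.symm hy)).unique hηy.differentiableAt.hasDerivAt.ofReal_comp

theorem iteratedDeriv_four_nonpos_of_pick {F h : ℂ → ℂ} {η : ℝ → ℝ}
    (hF : ∀ w : ℂ, 0 < w.im → DifferentiableAt ℂ F w) (hpos : ∀ w : ℂ, 0 < w.im → 0 ≤ (F w).im)
    (hbdd : ∀ δ > 0, ∃ M, ∀ w : ℂ, 0 < w.im → δ ≤ ‖w‖ → ‖F w‖ ≤ M) (hh : AnalyticAt ℂ h 0)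
    (hη : AnalyticAt ℝ η 0) (heq : ∀ᶠ x : ℝ in 𝓝 0, h x = η x)
    (hFh : ∀ᶠ w in 𝓝 (0 : ℂ), 0 < w.im → w * F w = -h w) : iteratedDeriv 4 η 0 ≤ 0 := by
  have hcoeff (k : ℕ) : taylorCoeff k h = taylorCoeff k η := by
    rw [taylorCoeff, taylorCoeff, ← Complex.ofReal_zero, iteratedDeriv_eq_ofReal_of_eventuallyEq
      (by simpa using hh) hη heq]
    push_cast
    rfl
  obtain ⟨g, hg, hgcoeff, hhg⟩ := exists_eq_sum_taylorCoeff_add hh 3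
  obtain ⟨γ, -, hγcoeff, hηγ⟩ := exists_eq_sum_taylorCoeff_add hη 3
  have hgγ : ∀ᶠ x : ℝ in 𝓝 0, g x = γ x := by
    filter_upwards [heq] with x hx
    rcases eq_or_ne x 0 with rfl | hx0
    · rw [Complex.ofReal_zero, ← taylorCoeff_zero g, ← taylorCoeff_zero γ, hgcoeff, hγcoeff, hcoeff]
    · have hx0' : (x : ℂ) ^ 3 ≠ 0 := pow_ne_zero _ (Complex.ofReal_ne_zero.2 hx0)
      rw [hhg, hηγ] at hx
      push_cast [hcoeff] at hx
      exact mul_left_cancel₀ hx0' (add_left_cancel hx)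
  have hexp : ∀ᶠ w in 𝓝 (0 : ℂ), 0 < w.im →
      F w * w⁻¹ ^ 2 + aeval w⁻¹ (∑ k ∈ Finset.range 3, C (taylorCoeff k η) * X ^ (3 - k)) =
        -g w := by
    filter_upwards [hFh] with w hw him
    have hw0 : w ≠ 0 := fun h => by simp [h] at him
    have hwF := hw him
    rw [hhg w] at hwF
    simp only [Finset.sum_range_succ, Finset.sum_range_zero, hcoeff, map_add, map_zero, map_mul,
      map_pow, aeval_X, aeval_C, Complex.coe_algebraMap, Nat.reduceSub] at hwF ⊢
    rw [eq_div_of_mul_eq hw0 ((mul_comm _ _).trans hwF)]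
    field_simp
    ring
  have hder := deriv_re_nonpos_of_pick hF hpos hbdd hg
    (hgγ.mono fun x hx => by rw [hx, Complex.ofReal_im]) hexp
  rw [← taylorCoeff_one, hgcoeff, hcoeff, Complex.ofReal_re] at hder
  rw [iteratedDeriv_zero_eq_factorial_mul]
  exact mul_nonpos_of_nonneg_of_nonpos (Nat.cast_nonneg _) hder

end PickTaylor

section DualBranch

theorem exists_comp_div_eq_inv {s : ℝ → ℝ} (hs : AnalyticAt ℝ s 0) (hs0 : s 0 ≠ 0) :
    ∃ v : ℝ → ℝ, AnalyticAt ℝ v 0 ∧ v 0 = (s 0)⁻¹ ∧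
      (∀ᶠ t in 𝓝 0, v (t / s t) = (s t)⁻¹) ∧ ∀ᶠ w in 𝓝 0, v w * s (w / v w) = 1 := by
  have hφ : AnalyticAt ℝ (fun t => t / s t) 0 := analyticAt_id.div hs hs0
  have hφ' : deriv (fun t => t / s t) 0 ≠ 0 := by
    have hder := (hasDerivAt_id' (0 : ℝ)).fun_div hs.differentiableAt.hasDerivAt hs0
    rw [hder.deriv]
    simp [hs0]
  have hψ := hφ.analyticAt_localInverse hφ'
  have hleft := hφ.hasStrictDerivAt.eventually_left_inverse hφ'
  have hright := hφ.hasStrictDerivAt.eventually_right_inverse hφ'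
  generalize hφ.hasStrictDerivAt.localInverse _ _ _ hφ' = ψ at hψ hleft hright
  rw [zero_div] at hψ hright
  have hψ0 : ψ 0 = 0 := by simpa using hleft.self_of_nhds
  have hsψ : AnalyticAt ℝ (fun w => s (ψ w)) 0 := AnalyticAt.fun_comp (by rwa [hψ0]) hψ
  refine ⟨fun w => (s (ψ w))⁻¹, hsψ.fun_inv (by rwa [hψ0]), by simp only [hψ0], ?_, ?_⟩
  · filter_upwards [hleft] with t ht
    rw [ht]
  · filter_upwards [hsψ.continuousAt.eventually_ne (by rwa [hψ0]), hright] with w hne hw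
    have hdiv : w / (s (ψ w))⁻¹ = ψ w := by
      rw [div_inv_eq_mul, ← eq_div_iff hne, hw]
    rw [hdiv, inv_mul_cancel₀ hne]

/-- The quartic case of Lagrange inversion, for the branch `v` of solutions of
`1 + v μ(w / v) = 0`. -/
theorem exists_dual_branch {μ : ℝ → ℝ} (hμ : AnalyticAt ℝ μ 0) (hμ0 : μ 0 ≠ 0) :
    ∃ v : ℝ → ℝ, AnalyticAt ℝ v 0 ∧ v 0 = -(μ 0)⁻¹ ∧
      (∀ᶠ w in 𝓝 0, 1 + v w * μ (w / v w) = 0) ∧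
      iteratedDeriv 4 (fun t => μ t ^ 3) 0 = 3 * iteratedDeriv 4 v 0 := by
  obtain ⟨v, hv, hv0, hvs, hsv⟩ := exists_comp_div_eq_inv hμ.fun_neg (neg_ne_zero.2 hμ0)
  have hcoeff := taylorCoeff_eq_neg_div_of_comp_div_eq_inv hμ.fun_neg (neg_ne_zero.2 hμ0) hv hvs 2
  have hcube : (fun t => (-μ t) ^ (2 + 1)) = fun t => -1 * μ t ^ 3 := by
    funext t
    ring
  rw [hcube, taylorCoeff_const_mul] at hcoeff
  refine ⟨v, hv, by rw [hv0, inv_neg], hsv.mono fun w hw => by linear_combination -hw, ?_⟩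
  rw [iteratedDeriv_zero_eq_factorial_mul, iteratedDeriv_zero_eq_factorial_mul, hcoeff]
  push_cast
  ring

end DualBranch

section Pencil

open Polynomial Matrix
open scoped Matrix.Norms.L2Operator

variable {ι : Type*} [Fintype ι] [DecidableEq ι]

theorem exists_polynomial_coeff_charpoly_add_smul (P Q : Matrix ι ι ℂ) (i : ℕ) :
    ∃ c : ℂ[X], ∀ z : ℂ, (P + z • Q).charpoly.coeff i = c.eval z := by
  let M : Matrix ι ι ℂ[X] := P.map C + (X : ℂ[X]) • Q.map C
  refine ⟨M.charpoly.coeff i, fun z => ?_⟩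
  have hM : P + z • Q = M.map (evalRingHom z) := by
    ext a b
    simp [M, mul_comm z]
  rw [hM, charpoly_map, coeff_map, coe_evalRingHom]

theorem analyticMonicFamily_charpoly (P Q : Matrix ι ι ℂ) (z₀ : ℂ) :
    AnalyticMonicFamily (fun z : ℂ => (P + z • Q).charpoly) (Fintype.card ι) z₀ where
  monic z := charpoly_monic _
  natDegree z := charpoly_natDegree_eq_dim _
  analyticAt i := by
    obtain ⟨c, hc⟩ := exists_polynomial_coeff_charpoly_add_smul P Q i
    simp only [hc]
    exact AnalyticOnNhd.eval_polynomial c z₀ (Set.mem_univ _)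

theorem charpoly_smul_eq_scaleRoots (K : Matrix ι ι ℂ) {w : ℂ} (hw : w ≠ 0) :
    (w • K).charpoly = K.charpoly.scaleRoots w := by
  refine Polynomial.funext fun x => ?_
  obtain ⟨y, rfl⟩ : ∃ y, x = w * y := ⟨w⁻¹ * x, (mul_inv_cancel_left₀ hw x).symm⟩
  rw [scaleRoots_eval_mul, eval_charpoly, eval_charpoly, charpoly_natDegree_eq_dim, ← det_smul,
    smul_sub, scalar_apply, scalar_apply, ← diagonal_smul]
  rfl

theorem roots_charpoly_smul (K : Matrix ι ι ℂ) {w : ℂ} (hw : w ≠ 0) :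
    (w • K).charpoly.roots = K.charpoly.roots.map fun r => w * r := by
  rw [charpoly_smul_eq_scaleRoots K hw, roots_scaleRoots _ hw.isUnit]

theorem norm_le_of_isRoot_charpoly {M : Matrix ι ι ℂ} {r : ℂ} (hr : M.charpoly.IsRoot r) :
    ‖r‖ ≤ ‖M‖ := by
  have hmem : r ∈ spectrum ℂ M := mem_spectrum_iff_isRoot_charpoly.2 hr
  cases subsingleton_or_nontrivial (Matrix ι ι ℂ)
  · simp [spectrum.of_subsingleton] at hmem
  · exact spectrum.norm_le_norm_of_mem hmem

theorem norm_signedRootSum_charpoly_le (c : ℂ) (M : Matrix ι ι ℂ) :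
    ‖signedRootSum c M.charpoly‖ ≤ Fintype.card ι * ‖M‖ := by
  have hcard : M.charpoly.roots.card = Fintype.card ι := by
    rw [← (IsAlgClosed.splits _).natDegree_eq_card_roots, charpoly_natDegree_eq_dim]
  refine (norm_multiset_sum_le _).trans ?_
  rw [Multiset.map_map, ← hcard, ← nsmul_eq_mul, ← Multiset.card_map]
  refine Multiset.sum_le_card_nsmul _ _ fun x hx => ?_
  obtain ⟨r, hr, rfl⟩ := Multiset.mem_map.1 hx
  rw [Function.comp_apply, norm_mul, Complex.norm_real]
  refine (mul_le_of_le_one_left (norm_nonneg _) ?_).trans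
    (norm_le_of_isRoot_charpoly (mem_roots'.1 hr).2)
  rcases SignType.sign (c * r).im <;> simp

theorem im_signedRootSum_one_nonneg (p : ℂ[X]) : 0 ≤ (signedRootSum 1 p).im := by
  rw [signedRootSum, ← Complex.coe_imAddGroupHom, map_multiset_sum, Multiset.map_map]
  refine Multiset.sum_nonneg fun x hx => ?_
  obtain ⟨z, -, rfl⟩ := Multiset.mem_map.1 hx
  rw [Function.comp_apply, Complex.coe_imAddGroupHom, Complex.im_ofReal_mul, one_mul,
    sign_mul_self]
  exact abs_nonneg _

theorem exists_form_eq_zero_of_det_eq_zero {A B : Matrix ι ι ℂ} (hA : A.IsHermitian)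
    (hB : B.IsHermitian) {α β γ : ℂ} (h : (α • (1 : Matrix ι ι ℂ) + β • A + γ • B).det = 0) :
    ∃ s a b : ℝ, 0 < s ∧ |b| ≤ ‖B‖ * s ∧ α * s + β * a + γ * b = 0 := by
  obtain ⟨y, hy0, hy⟩ := exists_mulVec_eq_zero_iff.2 h
  let x : EuclideanSpace ℂ ι := WithLp.toLp 2 y
  have hx0 : x ≠ 0 := by simpa [x] using hy0
  have hreal {M : Matrix ι ι ℂ} (hM : M.IsHermitian) :
      ((inner ℂ x (toEuclideanCLM (𝕜 := ℂ) M x)).re : ℂ) =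
        inner ℂ x (toEuclideanCLM (𝕜 := ℂ) M x) :=
    (isSymmetric_toEuclideanLin_iff.2 hM).coe_re_inner_self_apply x
  refine ⟨‖x‖ ^ 2, (inner ℂ x (toEuclideanCLM (𝕜 := ℂ) A x)).re,
    (inner ℂ x (toEuclideanCLM (𝕜 := ℂ) B x)).re, by positivity, ?_, ?_⟩
  · calc |(inner ℂ x (toEuclideanCLM (𝕜 := ℂ) B x)).re|
        ≤ ‖x‖ * ‖toEuclideanCLM (𝕜 := ℂ) B x‖ :=
          (Complex.abs_re_le_norm _).trans (norm_inner_le_norm _ _)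
      _ ≤ ‖x‖ * (‖B‖ * ‖x‖) := by gcongr; exact ContinuousLinearMap.le_opNorm _ _
      _ = ‖B‖ * ‖x‖ ^ 2 := by ring
  · have hker : toEuclideanCLM (𝕜 := ℂ) (α • (1 : Matrix ι ι ℂ) + β • A + γ • B) x = 0 := by
      rw [toEuclideanCLM_toLp, hy, WithLp.toLp_zero]
    have hinner := congrArg (inner ℂ x) hker
    have hnorm : ((‖x‖ ^ 2 : ℝ) : ℂ) = inner ℂ x x := by
      rw [inner_self_eq_norm_sq_to_K, Complex.ofReal_pow]
      rfl
    rw [hreal hA, hreal hB, hnorm]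
    simpa [inner_add_right, inner_smul_right] using hinner

variable {A B : Matrix ι ι ℂ}

/-- `A⁻¹ (z - B)`, whose eigenvalues `r` are the solutions of `det (r A + B - z) = 0`, written out
as an affine function of `z`. -/
noncomputable def slopeMatrix (A B : Matrix ι ι ℂ) (z : ℂ) : Matrix ι ι ℂ :=
  -(A⁻¹ * B) + z • A⁻¹

/-- `-A⁻¹ (1 + w B)`, whose eigenvalues `v` are the solutions of `det (1 + v A + w B) = 0`, written
out as an affine function of `w`. -/
noncomputable def dualMatrix (A B : Matrix ι ι ℂ) (w : ℂ) : Matrix ι ι ℂ :=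
  -A⁻¹ + w • -(A⁻¹ * B)

theorem dualMatrix_eq_smul {w : ℂ} (hw : w ≠ 0) :
    dualMatrix A B w = w • slopeMatrix A B (-w⁻¹) := by
  rw [slopeMatrix, smul_add, smul_smul, mul_neg, mul_inv_cancel₀ hw, neg_one_smul, dualMatrix,
    add_comm]

theorem eval_charpoly_dualMatrix (hA : IsUnit A) (v w : ℂ) :
    (dualMatrix A B w).charpoly.eval v =
      A⁻¹.det * ((1 : ℂ) • (1 : Matrix ι ι ℂ) + v • A + w • B).det := by
  have hdet : IsUnit A.det := (isUnit_iff_isUnit_det A).1 hA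
  rw [eval_charpoly, ← det_mul]
  congr 1
  simp only [dualMatrix, mul_add, Matrix.mul_smul, nonsing_inv_mul _ hdet, one_smul, mul_one,
    scalar_apply, ← smul_one_eq_diagonal, smul_neg]
  abel

theorem eval_charpoly_slopeMatrix (hA : IsUnit A) (r z : ℂ) :
    (slopeMatrix A B z).charpoly.eval r =
      A⁻¹.det * ((-z) • (1 : Matrix ι ι ℂ) + r • A + (1 : ℂ) • B).det := by
  have hdet : IsUnit A.det := (isUnit_iff_isUnit_det A).1 hA
  rw [eval_charpoly, ← det_mul]
  congr 1
  simp only [slopeMatrix, mul_add, Matrix.mul_smul, nonsing_inv_mul _ hdet, one_smul, mul_one,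
    scalar_apply, ← smul_one_eq_diagonal, neg_smul, mul_neg]
  abel

theorem det_inv_ne_zero (hA : IsUnit A) : A⁻¹.det ≠ 0 :=
  ((isUnit_iff_isUnit_det _).1 (isUnit_nonsing_inv_iff.2 hA)).ne_zero

theorem exists_form_of_isRoot_dualMatrix (hA : A.IsHermitian) (hB : B.IsHermitian)
    (hAu : IsUnit A) {v w : ℂ} (h : (dualMatrix A B w).charpoly.IsRoot v) :
    ∃ s a b : ℝ, 0 < s ∧ s + v * a + w * b = 0 := by
  rw [IsRoot.def, eval_charpoly_dualMatrix hAu] at h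
  obtain ⟨s, a, b, hs, -, hform⟩ :=
    exists_form_eq_zero_of_det_eq_zero hA hB ((mul_eq_zero.1 h).resolve_left (det_inv_ne_zero hAu))
  exact ⟨s, a, b, hs, by rwa [one_mul] at hform⟩

theorem exists_form_of_isRoot_slopeMatrix (hA : A.IsHermitian) (hB : B.IsHermitian)
    (hAu : IsUnit A) {r z : ℂ} (h : (slopeMatrix A B z).charpoly.IsRoot r) :
    ∃ s a b : ℝ, 0 < s ∧ |b| ≤ ‖B‖ * s ∧ r * a = z * s - b := by
  rw [IsRoot.def, eval_charpoly_slopeMatrix hAu] at h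
  obtain ⟨s, a, b, hs, hb, hform⟩ :=
    exists_form_eq_zero_of_det_eq_zero hA hB ((mul_eq_zero.1 h).resolve_left (det_inv_ne_zero hAu))
  exact ⟨s, a, b, hs, hb, by linear_combination hform⟩

theorem im_ne_zero_of_isRoot_slopeMatrix (hA : A.IsHermitian) (hB : B.IsHermitian)
    (hAu : IsUnit A) {r z : ℂ} (hz : 0 < z.im) (h : (slopeMatrix A B z).charpoly.IsRoot r) :
    r.im ≠ 0 := by
  obtain ⟨s, a, b, hs, -, hform⟩ := exists_form_of_isRoot_slopeMatrix hA hB hAu h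
  have him : r.im * a = z.im * s := by simpa using congrArg Complex.im hform
  exact left_ne_zero_of_mul (him.trans_ne (mul_pos hz hs).ne')

theorem re_ne_zero_of_isRoot_dualMatrix_zero (hA : A.IsHermitian) (hB : B.IsHermitian)
    (hAu : IsUnit A) {v : ℂ} (h : (dualMatrix A B 0).charpoly.IsRoot v) : v.re ≠ 0 := by
  obtain ⟨s, a, b, hs, hform⟩ := exists_form_of_isRoot_dualMatrix hA hB hAu h
  have hre : v.re * a = -s := by
    have := congrArg Complex.re hform
    simp only [zero_mul, add_zero, Complex.add_re, Complex.ofReal_re, Complex.mul_re,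
      Complex.ofReal_im, mul_zero, sub_zero, Complex.zero_re] at this
    linarith
  exact left_ne_zero_of_mul (hre.trans_ne (neg_ne_zero.2 hs.ne'))

theorem sign_eq_neg_sign_of_mul_neg_of_mul_pos {x y a : ℝ} (hx : x * a < 0) (hy : 0 < y * a) :
    SignType.sign x = -SignType.sign y := by
  rcases lt_trichotomy a 0 with ha | ha | ha
  · rw [sign_pos (pos_of_mul_neg_left hx ha.le), sign_neg (neg_of_mul_pos_left hy ha.le)]
    rfl
  · simp [ha] at hx
  · rw [sign_neg (neg_of_mul_neg_left hx ha.le), sign_pos (pos_of_mul_pos_left hy ha.le)]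

theorem neg_inv_im_pos {w : ℂ} (hw : 0 < w.im) : 0 < (-w⁻¹).im := by
  have hw0 : w ≠ 0 := fun h => by simp [h] at hw
  have : 0 < Complex.normSq w := Complex.normSq_pos.2 hw0
  rw [Complex.neg_im, Complex.inv_im, neg_div, neg_neg]
  positivity

theorem sign_re_eq_neg_sign_im_of_isRoot_slopeMatrix (hA : A.IsHermitian) (hB : B.IsHermitian)
    (hAu : IsUnit A) {r w : ℂ} (hw : 0 < w.im) (hwB : ‖w‖ * ‖B‖ < 1)
    (h : (slopeMatrix A B (-w⁻¹)).charpoly.IsRoot r) :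
    SignType.sign (w * r).re = -SignType.sign r.im := by
  obtain ⟨s, a, b, hs, hb, hform⟩ := exists_form_of_isRoot_slopeMatrix hA hB hAu h
  have hw0 : w ≠ 0 := fun h => by simp [h] at hw
  have hmul : w * r * a = -s - w * b := by
    rw [mul_assoc, hform]
    field_simp
  have him : r.im * a = (-w⁻¹).im * s := by simpa using congrArg Complex.im hform
  have hre : (w * r).re * a = -s - w.re * b := by simpa using congrArg Complex.re hmul
  have hsmall : |w.re * b| < s := by
    rw [abs_mul]
    calc |w.re| * |b| ≤ ‖w‖ * (‖B‖ * s) := by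
          gcongr
          exact Complex.abs_re_le_norm w
      _ = ‖w‖ * ‖B‖ * s := by ring
      _ < s := mul_lt_of_lt_one_left hs hwB
  refine sign_eq_neg_sign_of_mul_neg_of_mul_pos (a := a) ?_ ?_
  · rw [hre]
    linarith [neg_abs_le (w.re * b)]
  · rw [him]
    exact mul_pos (neg_inv_im_pos hw) hs

/-- The signed root sum of `A⁻¹ (z - B)` at `z = -1/w`. It maps the upper half plane to its closure
and continues `-1/w` times the signed root sum of `dualMatrix A B` across the origin. -/
noncomputable def pickFunction (A B : Matrix ι ι ℂ) (w : ℂ) : ℂ :=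
  signedRootSum 1 (slopeMatrix A B (-w⁻¹)).charpoly

theorem differentiableAt_pickFunction (hA : A.IsHermitian) (hB : B.IsHermitian) (hAu : IsUnit A)
    {w : ℂ} (hw : 0 < w.im) : DifferentiableAt ℂ (pickFunction A B) w := by
  have hw0 : w ≠ 0 := fun h => by simp [h] at hw
  have hsum : AnalyticAt ℂ (fun z => signedRootSum 1 (slopeMatrix A B z).charpoly) (-w⁻¹) :=
    (analyticMonicFamily_charpoly _ _ _).analyticAt_signedRootSum 1 fun z hz => by
      rw [one_mul]
      exact im_ne_zero_of_isRoot_slopeMatrix hA hB hAu (neg_inv_im_pos hw) hz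
  exact DifferentiableAt.comp (g := fun z => signedRootSum 1 (slopeMatrix A B z).charpoly) w
    hsum.differentiableAt (differentiableAt_inv hw0).fun_neg

theorem exists_norm_pickFunction_le (A B : Matrix ι ι ℂ) {δ : ℝ} (hδ : 0 < δ) :
    ∃ M, ∀ w : ℂ, δ ≤ ‖w‖ → ‖pickFunction A B w‖ ≤ M := by
  refine ⟨Fintype.card ι * (‖A⁻¹ * B‖ + δ⁻¹ * ‖A⁻¹‖), fun w hw => ?_⟩
  refine (norm_signedRootSum_charpoly_le 1 _).trans (mul_le_mul_of_nonneg_left ?_ (by positivity))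
  calc ‖slopeMatrix A B (-w⁻¹)‖ ≤ ‖-(A⁻¹ * B)‖ + ‖(-w⁻¹) • A⁻¹‖ := norm_add_le _ _
    _ = ‖A⁻¹ * B‖ + ‖w‖⁻¹ * ‖A⁻¹‖ := by rw [norm_neg, norm_smul, norm_neg, norm_inv]
    _ ≤ ‖A⁻¹ * B‖ + δ⁻¹ * ‖A⁻¹‖ := by gcongr

theorem mul_pickFunction (hA : A.IsHermitian) (hB : B.IsHermitian) (hAu : IsUnit A) {w : ℂ}
    (hw : 0 < w.im) (hwB : ‖w‖ * ‖B‖ < 1) :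
    w * pickFunction A B w = -signedRootSum Complex.I (dualMatrix A B w).charpoly := by
  have hw0 : w ≠ 0 := fun h => by simp [h] at hw
  rw [dualMatrix_eq_smul hw0, signedRootSum, roots_charpoly_smul _ hw0, Multiset.map_map,
    ← Multiset.sum_map_neg, pickFunction, signedRootSum, ← Multiset.sum_map_mul_left]
  refine congrArg Multiset.sum (Multiset.map_congr rfl fun r hr => ?_)
  rw [Function.comp_apply, Complex.I_mul_im, one_mul,
    sign_re_eq_neg_sign_im_of_isRoot_slopeMatrix hA hB hAu hw hwB (mem_roots'.1 hr).2]
  rcases SignType.sign r.im <;> simp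

theorem analyticAt_signedRootSum_dualMatrix (hA : A.IsHermitian) (hB : B.IsHermitian)
    (hAu : IsUnit A) :
    AnalyticAt ℂ (fun w => signedRootSum Complex.I (dualMatrix A B w).charpoly) 0 :=
  (analyticMonicFamily_charpoly _ _ _).analyticAt_signedRootSum _ fun v hv => by
    rw [Complex.I_mul_im]
    exact re_ne_zero_of_isRoot_dualMatrix_zero hA hB hAu hv

theorem iteratedDeriv_four_signedRootSum_nonpos (hA : A.IsHermitian) (hB : B.IsHermitian)
    (hAu : IsUnit A) {η : ℝ → ℝ} (hη : AnalyticAt ℝ η 0)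
    (h : ∀ᶠ x : ℝ in 𝓝 0, signedRootSum Complex.I (dualMatrix A B x).charpoly = η x) :
    iteratedDeriv 4 η 0 ≤ 0 := by
  refine iteratedDeriv_four_nonpos_of_pick (F := pickFunction A B)
    (fun w hw => differentiableAt_pickFunction hA hB hAu hw)
    (fun w _ => im_signedRootSum_one_nonneg _)
    (fun δ hδ => (exists_norm_pickFunction_le A B hδ).imp fun M hM w _ => hM w)
    (analyticAt_signedRootSum_dualMatrix hA hB hAu) hη h ?_
  have hc : ContinuousAt (fun w : ℂ => ‖w‖ * ‖B‖) 0 := by fun_prop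
  filter_upwards [hc.eventually_lt continuousAt_const (by simp : ‖(0 : ℂ)‖ * ‖B‖ < 1)]
    with w hwB hw
  exact mul_pickFunction hA hB hAu hw hwB

end Pencil

section Eigenvalues

open Polynomial Matrix

theorem roots_prod_X_sub_C_fun {ι R : Type*} [Fintype ι] [CommRing R] [IsDomain R] (f : ι → R) :
    (∏ i, (X - C (f i))).roots = Finset.univ.val.map f := by
  have := roots_multiset_prod_X_sub_C (Finset.univ.val.map f)
  rwa [Multiset.map_map] at this

theorem isHermitian_add_smul {ι : Type*} {A B : Matrix ι ι ℂ} (hA : A.IsHermitian)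
    (hB : B.IsHermitian) (t : ℝ) : (A + t • B).IsHermitian :=
  hA.add (hB.smul (IsSelfAdjoint.all t))

theorem map_ofReal_prod_X_sub_C {ι : Type*} [Fintype ι] (μ : ι → ℝ) :
    (∏ i, (X - C (μ i))).map Complex.ofRealHom = ∏ i, (X - C (μ i : ℂ)) := by
  simp [Polynomial.map_prod]

section Branches

variable {ι : Type*} [Fintype ι] [DecidableEq ι] {A B : Matrix ι ι ℂ}

theorem analyticMonicFamily_prod_X_sub_C_eigenvalues (hA : A.IsHermitian) (hB : B.IsHermitian)
    (t₀ : ℝ) :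
    AnalyticMonicFamily
      (fun t : ℝ => ∏ i, (X - C ((isHermitian_add_smul hA hB t).eigenvalues i)))
      (Fintype.card ι) t₀ := by
  refine ⟨fun t => monic_prod_X_sub_C _ _, fun t => by simp, fun i => ?_⟩
  obtain ⟨c, hc⟩ := exists_polynomial_coeff_charpoly_add_smul A B i
  have hcoeff : (fun t : ℝ =>
        (∏ j, (X - C ((isHermitian_add_smul hA hB t).eigenvalues j))).coeff i) =
      fun t : ℝ => (c.eval (t : ℂ)).re := by
    funext t
    rw [← hc, Complex.coe_smul, (isHermitian_add_smul hA hB t).charpoly_eq,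
      ← Complex.ofReal_re (coeff _ i), ← Complex.ofRealHom_eq_coe, ← coeff_map,
      map_ofReal_prod_X_sub_C]
    rfl
  rw [hcoeff]
  have hc_an : AnalyticAt ℂ (fun z : ℂ => c.eval z) (t₀ : ℂ) :=
    AnalyticOnNhd.eval_polynomial c _ (Set.mem_univ _)
  exact (Complex.reCLM.analyticAt _).comp <|
    (hc_an.restrictScalars (𝕜 := ℝ)).comp (f := fun t : ℝ => (t : ℂ))
      (Complex.ofRealCLM.analyticAt t₀)

theorem exists_analytic_eigenvalues (hA : A.IsHermitian) (hB : B.IsHermitian) (t₀ : ℝ) :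
    ∃ μ : ι → ℝ → ℝ, (∀ j, AnalyticAt ℝ (μ j) t₀) ∧
      ∀ᶠ t : ℝ in 𝓝 t₀, (A + t • B).charpoly = ∏ j, (X - C (μ j t : ℂ)) := by
  obtain ⟨μ, hμ, hprod⟩ :=
    (analyticMonicFamily_prod_X_sub_C_eigenvalues hA hB t₀).hasAnalyticRoots
      (.of_forall fun t => Splits.prod fun i _ => Splits.X_sub_C _)
  refine ⟨fun j => μ (Fintype.equivFin ι j), fun j => hμ _, ?_⟩
  filter_upwards [hprod] with t ht
  rw [(isHermitian_add_smul hA hB t).charpoly_eq,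
    (Fintype.equivFin ι).prod_comp fun i => X - C (μ i t : ℂ), ← map_ofReal_prod_X_sub_C, ← ht,
    map_ofReal_prod_X_sub_C]
  rfl

theorem ne_zero_of_charpoly_eq_prod {M : Matrix ι ι ℂ} (hM : IsUnit M) {μ : ι → ℝ}
    (h : M.charpoly = ∏ j, (X - C (μ j : ℂ))) (j : ι) : μ j ≠ 0 := by
  have hdet : M.det ≠ 0 := ((isUnit_iff_isUnit_det M).1 hM).ne_zero
  rw [det_eq_prod_roots_charpoly, h, roots_prod_X_sub_C_fun] at hdet
  exact_mod_cast Finset.prod_ne_zero_iff.1 hdet j (Finset.mem_univ j)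

end Branches

variable {n : ℕ}

theorem traceAbsCube_eq_sum_roots {M : Matrix (Fin n) (Fin n) ℂ} (hM : M.IsHermitian) :
    traceAbsCube M = (M.charpoly.roots.map fun z => ‖z‖ ^ 3).sum := by
  have hcube : CFC.abs M ^ 3 = cfc (fun x : ℝ => ‖x‖ ^ 3) M := by
    rw [CFC.abs_eq_cfc_norm M hM, cfc_pow (fun x : ℝ => ‖x‖) 3 M]
  rw [traceAbsCube, hcube, trace_eq_sum_roots_charpoly, hM.charpoly_cfc_eq,
    hM.roots_charpoly_eq_eigenvalues, roots_prod_X_sub_C_fun, Multiset.map_map]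
  change (∑ i, ((‖hM.eigenvalues i‖ ^ 3 : ℝ) : ℂ)).re = ∑ i, ‖(hM.eigenvalues i : ℂ)‖ ^ 3
  rw [← Complex.ofReal_sum, Complex.ofReal_re]
  simp only [Complex.norm_real]

theorem pencilTrace_eq_sum {A B : Matrix (Fin n) (Fin n) ℂ} (hA : A.IsHermitian)
    (hB : B.IsHermitian) {t : ℝ} {μ : Fin n → ℝ}
    (h : (A + t • B).charpoly = ∏ j, (X - C (μ j : ℂ))) :
    pencilTrace A B t = ∑ j, |μ j| ^ 3 := by
  rw [pencilTrace, traceAbsCube_eq_sum_roots (isHermitian_add_smul hA hB t), h,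
    roots_prod_X_sub_C_fun, Multiset.map_map]
  change ∑ j, ‖(μ j : ℂ)‖ ^ 3 = ∑ j, |μ j| ^ 3
  simp only [Complex.norm_real, Real.norm_eq_abs]

end Eigenvalues

section Matching

open Polynomial Matrix Asymptotics

theorem le_rootMultiplicity_of_isBigO {K : Type*} [NormedField K] {p : K[X]} (hp : p ≠ 0) {z₀ : K}
    {l : Filter K} [l.NeBot] (hl : l ≤ 𝓝[≠] z₀) {m : ℕ}
    (h : (fun z => p.eval z) =O[l] fun z => (z - z₀) ^ m) : m ≤ p.rootMultiplicity z₀ := by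
  obtain ⟨q, hpq, hdvd⟩ := exists_eq_pow_rootMultiplicity_mul_and_not_dvd p hp z₀
  set k := p.rootMultiplicity z₀
  by_contra! hkm
  have hne : ∀ᶠ z in l, z - z₀ ≠ 0 :=
    (eventually_mem_nhdsWithin.filter_mono hl).mono fun z => sub_ne_zero.2
  have hnhds : l ≤ 𝓝 z₀ := hl.trans nhdsWithin_le_nhds
  have hbigO : (fun z => q.eval z) =O[l] fun z => (z - z₀) ^ (m - k) := by
    refine ((isBigO_refl (fun z => ((z - z₀) ^ k)⁻¹) l).mul h).congr' ?_ ?_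
    · filter_upwards [hne] with z hz
      rw [hpq]
      simp [pow_ne_zero k hz]
    · filter_upwards [hne] with z hz
      rw [← Nat.add_sub_cancel' hkm.le, pow_add, inv_mul_cancel_left₀ (pow_ne_zero k hz),
        Nat.add_sub_cancel_left]
  have hsub : Tendsto (fun z => (z - z₀) ^ (m - k)) l (𝓝 0) := by
    have : ContinuousAt (fun z => (z - z₀) ^ (m - k)) z₀ := by fun_prop
    simpa [ContinuousAt, Nat.sub_ne_zero_of_lt hkm] using this.tendsto.mono_left hnhds
  have hq₀ : q.eval z₀ = 0 :=
    tendsto_nhds_unique (q.continuous.continuousAt.tendsto.mono_left hnhds)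
      (hbigO.trans_tendsto hsub)
  exact hdvd (dvd_iff_isRoot.2 hq₀)

theorem prod_isBigO_sub_pow_card {ι R 𝕜 : Type*} [Fintype ι] [DecidableEq R]
    [NontriviallyNormedField 𝕜] [NormedCommRing R] [NormedAlgebra 𝕜 R] {F : ι → 𝕜 → R} {x₀ : 𝕜}
    (hF : ∀ i, DifferentiableAt 𝕜 (F i) x₀) :
    (fun x => ∏ i, F i x) =O[𝓝 x₀] fun x => (x - x₀) ^ Fintype.card {i // F i x₀ = 0} := by
  have h : ∀ i ∈ Finset.univ, F i =O[𝓝 x₀] fun x => if F i x₀ = 0 then x - x₀ else 1 := by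
    intro i _
    split_ifs with hi
    · simpa [hi] using (hF i).isBigO_sub
    · exact (hF i).continuousAt.isBigO_one 𝕜
  refine (IsBigO.finsetProd h).congr_right fun x => ?_
  rw [Finset.prod_ite, Finset.prod_const, Finset.prod_const_one, mul_one, Fintype.card_subtype]

theorem signedRootSum_I_of_roots_eq {ι : Type*} [Fintype ι] {p : ℂ[X]}
    {v : ι → ℝ} (h : p.roots = Finset.univ.val.map fun j => (v j : ℂ)) :
    signedRootSum Complex.I p = ((∑ j, |v j| : ℝ) : ℂ) := by
  rw [signedRootSum, h, Multiset.map_map, Complex.ofReal_sum]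
  refine Finset.sum_congr rfl fun j _ => ?_
  rw [Function.comp_apply, Complex.I_mul_im, Complex.ofReal_re, ← Complex.ofReal_mul,
    sign_mul_self]

variable {ι : Type*} [Fintype ι] [DecidableEq ι] {A B : Matrix ι ι ℂ}

theorem eval_charpoly_dualMatrix_eq_prod (hAu : IsUnit A) {x w : ℝ} (hx : x ≠ 0) {μ : ι → ℝ}
    (h : (A + (w / x) • B).charpoly = ∏ j, (X - C (μ j : ℂ))) :
    (dualMatrix A B w).charpoly.eval (x : ℂ) = A⁻¹.det * ((∏ j, (1 + x * μ j) : ℝ) : ℂ) := by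
  have hx' : (x : ℂ) ≠ 0 := by exact_mod_cast hx
  have hsmul : (1 : ℂ) • (1 : Matrix ι ι ℂ) + (x : ℂ) • A + (w : ℂ) • B =
      (-x : ℂ) • (scalar ι (-(x : ℂ)⁻¹) - (A + (w / x) • B)) := by
    rw [scalar_apply, ← smul_one_eq_diagonal, ← Complex.coe_smul (w / x) B, Complex.ofReal_div,
      smul_sub, smul_add, smul_smul, smul_smul, neg_mul_neg, mul_inv_cancel₀ hx', neg_mul,
      mul_div_cancel₀ _ hx']
    module
  rw [eval_charpoly_dualMatrix hAu, hsmul, det_smul, ← eval_charpoly, h, eval_prod,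
    ← Finset.card_univ, ← Finset.prod_const, ← Finset.prod_mul_distrib, Complex.ofReal_prod]
  congr 1
  refine Finset.prod_congr rfl fun j _ => ?_
  simp only [eval_sub, eval_X, eval_C, mul_sub, neg_mul_neg, mul_inv_cancel₀ hx']
  push_cast
  ring

theorem card_le_rootMultiplicity_charpoly_dualMatrix (hAu : IsUnit A) {x₀ w : ℝ} (hx₀ : x₀ ≠ 0)
    {μ : ι → ℝ → ℝ} (hμ : ∀ j, DifferentiableAt ℝ (μ j) (w / x₀))
    (h : ∀ᶠ t : ℝ in 𝓝 (w / x₀), (A + t • B).charpoly = ∏ j, (X - C (μ j t : ℂ))) :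
    Fintype.card {j // 1 + x₀ * μ j (w / x₀) = 0} ≤
      (dualMatrix A B w).charpoly.rootMultiplicity (x₀ : ℂ) := by
  have hdiv : DifferentiableAt ℝ (fun x : ℝ => w / x) x₀ := by fun_prop (disch := exact hx₀)
  have hF : ∀ j, DifferentiableAt ℝ (fun x => 1 + x * μ j (w / x)) x₀ := fun j =>
    (differentiableAt_id.mul ((hμ j).comp x₀ hdiv)).const_add 1
  have hne : Tendsto ((↑) : ℝ → ℂ) (𝓝[≠] x₀) (𝓝[≠] (x₀ : ℂ)) :=
    Complex.continuous_ofReal.continuousWithinAt.tendsto_nhdsWithin fun x hx => by simpa using hx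
  refine le_rootMultiplicity_of_isBigO (charpoly_monic _).ne_zero
    (l := map Complex.ofReal (𝓝[≠] x₀)) hne ?_
  rw [isBigO_map]
  refine IsBigO.mono ?_ nhdsWithin_le_nhds
  have hbigO := (Complex.isBigO_ofReal_left.2 (prod_isBigO_sub_pow_card hF)).const_mul_left A⁻¹.det
  refine (Complex.isBigO_ofReal_right.2 hbigO).congr' ?_ (.of_forall fun x => by simp)
  filter_upwards [hdiv.continuousAt.eventually h, continuousAt_id.eventually_ne hx₀] with x hx hx0
  exact (eval_charpoly_dualMatrix_eq_prod hAu hx0 hx).symm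

theorem roots_charpoly_dualMatrix (hAu : IsUnit A) {w : ℝ} {v : ι → ℝ} (hv : ∀ j, v j ≠ 0)
    {μ : ι → ℝ → ℝ} (hμ : ∀ j i, DifferentiableAt ℝ (μ i) (w / v j))
    (h : ∀ j, ∀ᶠ t : ℝ in 𝓝 (w / v j), (A + t • B).charpoly = ∏ i, (X - C (μ i t : ℂ)))
    (hvμ : ∀ j, 1 + v j * μ j (w / v j) = 0) :
    (dualMatrix A B w).charpoly.roots = Finset.univ.val.map fun j => (v j : ℂ) := by
  refine (Multiset.eq_of_le_of_card_le (Multiset.le_iff_count.2 fun a => ?_) ?_).symm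
  · by_cases ha : a ∈ Finset.univ.val.map fun j => (v j : ℂ)
    · obtain ⟨i, -, rfl⟩ := Multiset.mem_map.1 ha
      rw [count_roots, Multiset.count_map, ← Finset.filter_val, Finset.card_val]
      refine (Finset.card_le_card fun j hj => ?_).trans <|
        (Fintype.card_subtype _).symm.trans_le <|
          card_le_rootMultiplicity_charpoly_dualMatrix hAu (hv i) (hμ i) (h i)
      have hij : v i = v j := by exact_mod_cast (Finset.mem_filter.1 hj).2
      rw [Finset.mem_filter, hij]
      exact ⟨Finset.mem_univ j, hvμ j⟩
    · simp [Multiset.count_eq_zero_of_notMem ha]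
  · exact (card_roots' _).trans (by simp [charpoly_natDegree_eq_dim])

theorem eventually_roots_charpoly_dualMatrix (hAu : IsUnit A) {μ v : ι → ℝ → ℝ}
    (hμ : ∀ j, AnalyticAt ℝ (μ j) 0)
    (h : ∀ᶠ t : ℝ in 𝓝 0, (A + t • B).charpoly = ∏ j, (X - C (μ j t : ℂ)))
    (hv : ∀ j, ContinuousAt (v j) 0) (hv0 : ∀ j, v j 0 ≠ 0)
    (hvμ : ∀ j, ∀ᶠ w in 𝓝 (0 : ℝ), 1 + v j w * μ j (w / v j w) = 0) :
    ∀ᶠ w : ℝ in 𝓝 0,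
      (dualMatrix A B w).charpoly.roots = Finset.univ.val.map fun j => (v j w : ℂ) := by
  have hlim : ∀ j, Tendsto (fun w => w / v j w) (𝓝 0) (𝓝 0) := fun j => by
    have hcont : ContinuousAt (fun w => w / v j w) 0 := continuousAt_id.div (hv j) (hv0 j)
    simpa [ContinuousAt] using hcont
  have hne : ∀ᶠ w in 𝓝 (0 : ℝ), ∀ j, v j w ≠ 0 :=
    eventually_all.2 fun j => (hv j).eventually_ne (hv0 j)
  have hchar : ∀ᶠ w in 𝓝 (0 : ℝ), ∀ j, ∀ᶠ t in 𝓝 (w / v j w),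
      (A + t • B).charpoly = ∏ j, (X - C (μ j t : ℂ)) :=
    eventually_all.2 fun j => (hlim j).eventually (eventually_eventually_nhds.2 h)
  have hdiff : ∀ᶠ w in 𝓝 (0 : ℝ), ∀ j i, DifferentiableAt ℝ (μ i) (w / v j w) :=
    eventually_all.2 fun j => eventually_all.2 fun i => (hlim j).eventually <|
      (hμ i).eventually_analyticAt.mono fun _ => AnalyticAt.differentiableAt
  filter_upwards [hne, hchar, hdiff, eventually_all.2 hvμ] with w hne hchar hdiff hvμ
  exact roots_charpoly_dualMatrix hAu hne hdiff hchar hvμ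

end Matching

section Positivity

open Polynomial Matrix

theorem eventually_abs_eq_sign_mul {X : Type*} [TopologicalSpace X] {f : X → ℝ} {x : X}
    (hf : ContinuousAt f x) (h : f x ≠ 0) :
    ∀ᶠ y in 𝓝 x, |f y| = SignType.sign (f x) * f y := by
  have hsign : ∀ᶠ y in 𝓝 x, SignType.sign (f y) = SignType.sign (f x) :=
    tendsto_pure.1 (nhds_discrete SignType ▸ ((continuousAt_sign_of_ne_zero h).comp hf).tendsto)
  filter_upwards [hsign] with y hy
  rw [← hy, sign_mul_self]

theorem sign_inv_eq_sign {K : Type*} [Field K] [LinearOrder K] [IsStrictOrderedRing K] (x : K) :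
    SignType.sign x⁻¹ = SignType.sign x := by
  rcases lt_trichotomy x 0 with h | rfl | h
  · rw [sign_neg h, sign_neg (inv_lt_zero.2 h)]
  · simp
  · rw [sign_pos h, sign_pos (inv_pos.2 h)]

theorem iteratedDeriv_sum_const_mul {𝕜 ι : Type*} [NontriviallyNormedField 𝕜] [Fintype ι]
    {f : ι → 𝕜 → 𝕜} {x : 𝕜} {k : ℕ} (c : ι → 𝕜) (hf : ∀ i, ContDiffAt 𝕜 k (f i) x) :
    iteratedDeriv k (fun t => ∑ i, c i * f i t) x = ∑ i, c i * iteratedDeriv k (f i) x := by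
  rw [iteratedDeriv_fun_sum fun i _ => contDiffAt_const.mul (hf i)]
  exact Finset.sum_congr rfl fun i _ => iteratedDeriv_const_mul _ (hf i)

variable {n : ℕ} {A B : Matrix (Fin n) (Fin n) ℂ}

theorem pencilTrace_eventuallyEq_sum_sign_mul (hA : A.IsHermitian) (hB : B.IsHermitian) {t₀ : ℝ}
    {μ : Fin n → ℝ → ℝ} (hμ : ∀ j, ContinuousAt (μ j) t₀) (hμ₀ : ∀ j, μ j t₀ ≠ 0)
    (h : ∀ᶠ t : ℝ in 𝓝 t₀, (A + t • B).charpoly = ∏ j, (X - C (μ j t : ℂ))) :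
    pencilTrace A B =ᶠ[𝓝 t₀] fun t => ∑ j, SignType.sign (μ j t₀) * μ j t ^ 3 := by
  filter_upwards [h, eventually_all.2 fun j => eventually_abs_eq_sign_mul (hμ j) (hμ₀ j)]
    with t hchar habs
  rw [pencilTrace_eq_sum hA hB hchar]
  refine Finset.sum_congr rfl fun j _ => ?_
  rw [pow_succ', sq_abs, habs]
  ring

theorem analyticAt_pencilTrace (hA : A.IsHermitian) (hB : B.IsHermitian) {t₀ : ℝ}
    (ht₀ : IsUnit (A + t₀ • B)) : AnalyticAt ℝ (pencilTrace A B) t₀ := by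
  obtain ⟨μ, hμ, h⟩ := exists_analytic_eigenvalues hA hB t₀
  have hμ₀ := ne_zero_of_charpoly_eq_prod ht₀ h.self_of_nhds
  refine AnalyticAt.congr ?_
    (pencilTrace_eventuallyEq_sum_sign_mul hA hB (fun j => (hμ j).continuousAt) hμ₀ h).symm
  exact Finset.analyticAt_fun_sum _ fun j _ => analyticAt_const.mul ((hμ j).pow 3)

theorem sum_sign_mul_iteratedDeriv_four_nonpos {ι : Type*} [Fintype ι] [DecidableEq ι]
    {A B : Matrix ι ι ℂ} (hA : A.IsHermitian) (hB : B.IsHermitian) (hAu : IsUnit A)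
    {v : ι → ℝ → ℝ} (hv : ∀ j, AnalyticAt ℝ (v j) 0) (hv0 : ∀ j, v j 0 ≠ 0)
    (h : ∀ᶠ w : ℝ in 𝓝 0,
      (dualMatrix A B w).charpoly.roots = Finset.univ.val.map fun j => (v j w : ℂ)) :
    ∑ j, SignType.sign (v j 0) * iteratedDeriv 4 (v j) 0 ≤ 0 := by
  rw [← iteratedDeriv_sum_const_mul _ fun j => (hv j).contDiffAt]
  refine iteratedDeriv_four_signedRootSum_nonpos hA hB hAu
    (Finset.analyticAt_fun_sum _ fun j _ => analyticAt_const.mul (hv j)) ?_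
  filter_upwards [h, eventually_all.2 fun j =>
    eventually_abs_eq_sign_mul (hv j).continuousAt (hv0 j)] with w hroots habs
  rw [signedRootSum_I_of_roots_eq hroots]
  simp only [habs]

theorem iteratedDeriv_four_pencilTrace_zero_nonneg (hA : A.IsHermitian) (hB : B.IsHermitian)
    (hAu : IsUnit A) : 0 ≤ iteratedDeriv 4 (pencilTrace A B) 0 := by
  obtain ⟨μ, hμ, h⟩ := exists_analytic_eigenvalues hA hB 0
  have hμ0 : ∀ j, μ j 0 ≠ 0 :=
    ne_zero_of_charpoly_eq_prod (by rwa [zero_smul, add_zero]) h.self_of_nhds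
  choose v hv hv0 hvμ h4 using fun j => exists_dual_branch (hμ j) (hμ0 j)
  have hv0_ne : ∀ j, v j 0 ≠ 0 := fun j => by
    rw [hv0]
    exact neg_ne_zero.2 (inv_ne_zero (hμ0 j))
  have hsign : ∀ j, SignType.sign (μ j 0) = -SignType.sign (v j 0) := fun j => by
    rw [hv0, Left.sign_neg, neg_neg, sign_inv_eq_sign]
  have hroots := eventually_roots_charpoly_dualMatrix hAu hμ h (fun j => (hv j).continuousAt)
    hv0_ne hvμ
  have hdual := sum_sign_mul_iteratedDeriv_four_nonpos hA hB hAu hv hv0_ne hroots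
  calc
    0 ≤ -3 * ∑ j, SignType.sign (v j 0) * iteratedDeriv 4 (v j) 0 := by linarith
    _ = ∑ j, SignType.sign (μ j 0) * iteratedDeriv 4 (fun t => μ j t ^ 3) 0 := by
      rw [Finset.mul_sum]
      refine Finset.sum_congr rfl fun j _ => ?_
      rw [h4, hsign, SignType.coe_neg]
      ring
    _ = iteratedDeriv 4 (pencilTrace A B) 0 := by
      rw [(pencilTrace_eventuallyEq_sum_sign_mul hA hB (fun j => (hμ j).continuousAt) hμ0
          h).iteratedDeriv_eq 4,
        iteratedDeriv_sum_const_mul (f := fun j t => μ j t ^ 3) _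
          fun j => ((hμ j).pow 3).contDiffAt]

theorem iteratedDeriv_four_pencilTrace_nonneg (hA : A.IsHermitian) (hB : B.IsHermitian) {t₀ : ℝ}
    (ht₀ : IsUnit (A + t₀ • B)) : 0 ≤ iteratedDeriv 4 (pencilTrace A B) t₀ := by
  have htranslate : pencilTrace (A + t₀ • B) B = fun t => pencilTrace A B (t₀ + t) := by
    funext t
    rw [pencilTrace, pencilTrace, add_smul, add_assoc]
  have h := iteratedDeriv_four_pencilTrace_zero_nonneg (isHermitian_add_smul hA hB t₀) hB ht₀
  simpa [htranslate, iteratedDeriv_comp_const_add] using h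

end Positivity

section SingularSet

open Polynomial Matrix

theorem eval_det_X_smul_add {ι R : Type*} [Fintype ι] [DecidableEq ι] [CommRing R]
    (A B : Matrix ι ι R) (t : R) :
    (det ((X : R[X]) • B.map C + A.map C)).eval t = (A + t • B).det := by
  rw [← coe_evalRingHom, RingHom.map_det]
  congr 1
  ext i j
  simp [add_comm (A i j), mul_comm t]

variable {ι : Type*} [Fintype ι] [DecidableEq ι] {A B : Matrix ι ι ℂ}

theorem finite_setOf_not_isUnit_add_smul_of_det_ne_zero
    (h : det ((X : ℂ[X]) • B.map C + A.map C) ≠ 0) :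
    {t : ℝ | ¬IsUnit (A + t • B)}.Finite := by
  refine ((finite_setOfPred_isRoot h).preimage Complex.ofReal_injective.injOn).subset fun t ht => ?_
  rw [Set.mem_ofPred_eq, isUnit_iff_isUnit_det, isUnit_iff_ne_zero, not_not] at ht
  rw [Set.mem_preimage, Set.mem_ofPred_eq, IsRoot.def, eval_det_X_smul_add, Complex.coe_smul, ht]

theorem finite_setOf_not_isUnit_add_smul {t₀ : ℝ} (ht₀ : IsUnit (A + t₀ • B)) :
    {t : ℝ | ¬IsUnit (A + t • B)}.Finite := by
  refine finite_setOf_not_isUnit_add_smul_of_det_ne_zero fun h => ?_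
  have hdet := eval_det_X_smul_add A B t₀
  rw [h, eval_zero, Complex.coe_smul] at hdet
  exact ((isUnit_iff_isUnit_det _).1 ht₀).ne_zero hdet.symm

theorem exists_isUnit_add_smul (A : Matrix ι ι ℂ) (hB : IsUnit B) :
    ∃ t : ℝ, IsUnit (A + t • B) := by
  refine (finite_setOf_not_isUnit_add_smul_of_det_ne_zero (A := A) fun h => ?_).exists_notMem.imp
    fun t => not_not.1
  have hdet := coeff_det_X_add_C_card B A
  rw [h, coeff_zero] at hdet
  exact ((isUnit_iff_isUnit_det _).1 hB).ne_zero hdet.symm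

end SingularSet

section Cusp

theorem hasDerivAt_pow_succ_mul_abs (k : ℕ) (x : ℝ) :
    HasDerivAt (fun x : ℝ => x ^ (k + 1) * |x|) ((k + 2) * (x ^ k * |x|)) x := by
  rcases eq_or_ne x 0 with rfl | hx
  · rw [abs_zero, mul_zero, mul_zero, hasDerivAt_iff_tendsto_slope]
    have hlim : Tendsto (fun x : ℝ => x ^ k * |x|) (𝓝[≠] 0) (𝓝 0) := by
      have hcont : Continuous fun x : ℝ => x ^ k * |x| := by fun_prop
      simpa using (hcont.tendsto 0).mono_left nhdsWithin_le_nhds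
    refine hlim.congr' ?_
    filter_upwards [self_mem_nhdsWithin] with y (hy : y ≠ 0)
    rw [slope_def_field, abs_zero, mul_zero, sub_zero, sub_zero, pow_succ']
    field_simp
  · refine ((hasDerivAt_pow (k + 1) x).mul (hasDerivAt_abs hx)).congr_deriv ?_
    rw [← sign_mul_self x]
    push_cast
    ring

theorem contDiff_pow_mul_abs (k : ℕ) : ContDiff ℝ k fun x : ℝ => x ^ k * |x| := by
  induction k with
  | zero => simpa using continuous_abs
  | succ k ih =>
    rw [Nat.cast_succ, contDiff_succ_iff_deriv,
      funext fun x => (hasDerivAt_pow_succ_mul_abs k x).deriv]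
    exact ⟨fun x => (hasDerivAt_pow_succ_mul_abs k x).differentiableAt, by simp,
      contDiff_const.mul ih⟩

/-- The model `C |t - c|³ + D |t - c|³ (t - c)` of the singularities that `tr |A + t B|³` can have
at a point `c` where `A + c B` is singular. -/
noncomputable def cuspModel (C D c t : ℝ) : ℝ :=
  C * |t - c| ^ 3 + D * (|t - c| ^ 3 * (t - c))

variable {C D c t : ℝ}

theorem cuspModel_eq (C D c t : ℝ) :
    cuspModel C D c t = C * ((t - c) ^ 2 * |t - c|) + D * ((t - c) ^ 3 * |t - c|) := by
  rw [cuspModel, pow_succ, sq_abs]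
  ring

theorem cuspModel_eventuallyEq (C D : ℝ) (ht : t ≠ c) :
    cuspModel C D c =ᶠ[𝓝 t] fun x =>
      SignType.sign (t - c) * (C * (x - c) ^ 3 + D * (x - c) ^ 4) := by
  have hcont : ContinuousAt (fun x => x - c) t := by fun_prop
  filter_upwards [eventually_abs_eq_sign_mul hcont (sub_ne_zero.2 ht)] with x hx
  rw [cuspModel_eq, hx]
  ring

theorem contDiffAt_cuspModel (C D : ℝ) {m : ℕ∞ω} (ht : t ≠ c) :
    ContDiffAt ℝ m (cuspModel C D c) t :=
  ContDiffAt.congr_of_eventuallyEq (by fun_prop) (cuspModel_eventuallyEq C D ht)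

theorem iteratedDeriv_four_cuspModel (C D : ℝ) (ht : t ≠ c) :
    iteratedDeriv 4 (cuspModel C D c) t = D * (24 * SignType.sign (t - c)) := by
  have hcube (x : ℝ) : iteratedDeriv 4 (fun x => x ^ 3) x = 0 := by simp [Nat.descFactorial]
  have hfour (x : ℝ) : iteratedDeriv 4 (fun x => x ^ 4) x = 24 := by simp [Nat.descFactorial]
  rw [(cuspModel_eventuallyEq C D ht).iteratedDeriv_eq 4,
    iteratedDeriv_comp_sub_const 4 (fun x => SignType.sign (t - c) * (C * x ^ 3 + D * x ^ 4))]
  beta_reduce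
  rw [iteratedDeriv_const_mul_field, iteratedDeriv_fun_add (by fun_prop) (by fun_prop),
    iteratedDeriv_const_mul_field, iteratedDeriv_const_mul_field, hcube, hfour]
  ring

end Cusp

section LocalForm

theorem exists_abs_eventuallyEq_abs_pow_mul {μ : ℝ → ℝ} {c : ℝ} (hμ : AnalyticAt ℝ μ c) :
    ∃ (k : ℕ) (G : ℝ → ℝ), AnalyticAt ℝ G c ∧ 0 ≤ G c ∧
      ∀ᶠ t in 𝓝 c, |μ t| = |t - c| ^ k * G t := by
  by_cases h : ∀ᶠ t in 𝓝 c, μ t = 0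
  · refine ⟨0, 0, analyticAt_const, le_rfl, h.mono fun t ht => ?_⟩
    simp [ht]
  · obtain ⟨k, g, hg, hgc, hμg⟩ := hμ.exists_eventuallyEq_pow_smul_nonzero_iff.2 h
    refine ⟨k, fun t => SignType.sign (g c) * g t, analyticAt_const.mul hg, ?_, ?_⟩
    · exact (abs_nonneg (g c)).trans_eq (sign_mul_self (g c)).symm
    · filter_upwards [hμg, eventually_abs_eq_sign_mul hg.continuousAt hgc] with t hμt hgt
      rw [hμt, smul_eq_mul, abs_mul, abs_pow, hgt]

theorem exists_abs_cube_eventuallyEq_add {μ : ℝ → ℝ} {c : ℝ} (hμ : AnalyticAt ℝ μ c) :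
    ∃ a b : ℝ → ℝ, AnalyticAt ℝ a c ∧ AnalyticAt ℝ b c ∧ 0 ≤ b c ∧
      ∀ᶠ t in 𝓝 c, |μ t| ^ 3 = a t + |t - c| ^ 3 * b t := by
  obtain ⟨k, G, hG, hGc, hμG⟩ := exists_abs_eventuallyEq_abs_pow_mul hμ
  have hx : AnalyticAt ℝ (fun t => t - c) c := analyticAt_id.sub analyticAt_const
  rcases Nat.even_or_odd k with hk | ⟨m, rfl⟩
  · refine ⟨fun t => (t - c) ^ (k * 3) * G t ^ 3, 0, (hx.pow _).mul (hG.pow 3),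
      analyticAt_const, le_rfl, hμG.mono fun t ht => ?_⟩
    rw [ht, mul_pow, ← pow_mul, (hk.mul_right 3).pow_abs, Pi.zero_apply, mul_zero, add_zero]
  · have heven : Even (6 * m) := (by decide : Even 6).mul_right m
    refine ⟨0, fun t => (t - c) ^ (6 * m) * G t ^ 3, analyticAt_const,
      (hx.pow _).mul (hG.pow 3), mul_nonneg (heven.pow_nonneg _) (pow_nonneg hGc 3),
      hμG.mono fun t ht => ?_⟩
    beta_reduce
    rw [ht, ← heven.pow_abs, Pi.zero_apply]
    ring

theorem exists_eventuallyEq_cuspModel_add {T a b : ℝ → ℝ} {c : ℝ} (ha : AnalyticAt ℝ a c)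
    (hb : AnalyticAt ℝ b c) (hT : ∀ᶠ t in 𝓝 c, T t = a t + |t - c| ^ 3 * b t) :
    ∃ f : ℝ → ℝ, ContDiffAt ℝ 4 f c ∧
      ∀ᶠ t in 𝓝 c, T t = cuspModel (b c) (deriv b c) c t + f t := by
  refine ⟨fun t => a t + (t - c) ^ 4 * |t - c| * dslope (dslope b c) c t, ?_,
    hT.mono fun t ht => ?_⟩
  · have hpow : ContDiffAt ℝ 4 (fun t : ℝ => (t - c) ^ 4 * |t - c|) c :=
      ((contDiff_pow_mul_abs 4).comp (contDiff_id.sub contDiff_const)).contDiffAt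
    obtain ⟨p, hp⟩ := hb
    have hdslope : AnalyticAt ℝ (dslope (dslope b c) c) c :=
      ⟨_, hp.has_fpower_series_dslope_fslope.has_fpower_series_dslope_fslope⟩
    exact ha.contDiffAt.add (hpow.mul hdslope.contDiffAt)
  · have htaylor : b t = b c + (t - c) * (deriv b c + (t - c) * dslope (dslope b c) c t) := by
      have h₁ := sub_smul_dslope b c t
      have h₂ := sub_smul_dslope (dslope b c) c t
      rw [smul_eq_mul] at h₁ h₂
      rw [h₂, dslope_same, add_sub_cancel, h₁, add_sub_cancel]
    rw [ht, htaylor, cuspModel_eq, pow_succ |t - c|, sq_abs]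
    ring

theorem exists_pencilTrace_eventuallyEq_cuspModel_add {n : ℕ} {A B : Matrix (Fin n) (Fin n) ℂ}
    (hA : A.IsHermitian) (hB : B.IsHermitian) (c : ℝ) :
    ∃ C D : ℝ, 0 ≤ C ∧ ∃ f : ℝ → ℝ, ContDiffAt ℝ 4 f c ∧
      ∀ᶠ t in 𝓝 c, pencilTrace A B t = cuspModel C D c t + f t := by
  obtain ⟨μ, hμ, h⟩ := exists_analytic_eigenvalues hA hB c
  choose a b ha hb hbc hab using fun j => exists_abs_cube_eventuallyEq_add (hμ j)
  have ha' : AnalyticAt ℝ (fun t => ∑ j, a j t) c := Finset.analyticAt_fun_sum _ fun j _ => ha j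
  have hb' : AnalyticAt ℝ (fun t => ∑ j, b j t) c := Finset.analyticAt_fun_sum _ fun j _ => hb j
  refine ⟨∑ j, b j c, _, Finset.sum_nonneg fun j _ => hbc j,
    exists_eventuallyEq_cuspModel_add ha' hb' ?_⟩
  filter_upwards [h, eventually_all.2 hab] with t hchar hab
  rw [pencilTrace_eq_sum hA hB hchar, Finset.sum_congr rfl fun j _ => hab j,
    Finset.sum_add_distrib, Finset.mul_sum]

end LocalForm

section DistributionalDerivative

variable {φ : ℝ → ℝ}

theorem integrable_mul_of_hasCompactSupport {u : ℝ → ℝ} (hu : LocallyIntegrable u)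
    (hφ : Continuous φ) (hs : HasCompactSupport φ) : Integrable fun t => u t * φ t := by
  simpa only [smul_eq_mul, mul_comm] using hu.integrable_smul_left_of_hasCompactSupport hφ hs

theorem hasCompactSupport_iteratedDeriv (hs : HasCompactSupport φ) (k : ℕ) :
    HasCompactSupport (iteratedDeriv k φ) := by
  induction k with
  | zero => rwa [iteratedDeriv_zero]
  | succ k ih =>
    rw [iteratedDeriv_succ]
    exact ih.deriv

theorem contDiff_infty_iteratedDeriv (hφ : ContDiff ℝ ∞ φ) (k : ℕ) :
    ContDiff ℝ ∞ (iteratedDeriv k φ) :=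
  iteratedDeriv_eq_iterate (f := φ) ▸ hφ.iterate_deriv k

/-- The `k`-th distributional derivative of the locally integrable function `f` on `ℝ` is the
linear form `L` on test functions: `HasDistribDerivMeasure` with an arbitrary linear form in place
of the measure, so that it can be computed term by term. -/
def HasDistribDeriv (k : ℕ) (f : ℝ → ℝ) (L : (ℝ → ℝ) → ℝ) : Prop :=
  LocallyIntegrable f ∧ ∀ φ : ℝ → ℝ, ContDiff ℝ ∞ φ → HasCompactSupport φ →
    (-1 : ℝ) ^ k * ∫ t, f t * iteratedDeriv k φ t = L φ

namespace HasDistribDeriv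

variable {k : ℕ} {f g : ℝ → ℝ} {L M : (ℝ → ℝ) → ℝ}

theorem integrable_mul (hf : HasDistribDeriv k f L) (hφ : ContDiff ℝ ∞ φ)
    (hs : HasCompactSupport φ) : Integrable fun t => f t * iteratedDeriv k φ t :=
  integrable_mul_of_hasCompactSupport hf.1 (contDiff_infty_iteratedDeriv hφ k).continuous
    (hasCompactSupport_iteratedDeriv hs k)

theorem congr (hf : HasDistribDeriv k f L)
    (hLM : ∀ φ, ContDiff ℝ ∞ φ → HasCompactSupport φ → L φ = M φ) : HasDistribDeriv k f M :=
  ⟨hf.1, fun φ hφ hs => (hf.2 φ hφ hs).trans (hLM φ hφ hs)⟩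

theorem add (hf : HasDistribDeriv k f L) (hg : HasDistribDeriv k g M) :
    HasDistribDeriv k (fun t => f t + g t) fun φ => L φ + M φ := by
  refine ⟨hf.1.add hg.1, fun φ hφ hs => ?_⟩
  simp only [add_mul]
  rw [integral_add (hf.integrable_mul hφ hs) (hg.integrable_mul hφ hs), mul_add, hf.2 φ hφ hs,
    hg.2 φ hφ hs]

theorem const_mul (hf : HasDistribDeriv k f L) (a : ℝ) :
    HasDistribDeriv k (fun t => a * f t) fun φ => a * L φ := by
  refine ⟨hf.1.smul a, fun φ hφ hs => ?_⟩
  simp only [mul_assoc]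
  rw [integral_const_mul, mul_left_comm, hf.2 φ hφ hs]

theorem sum {ι : Type*} {s : Finset ι} {f : ι → ℝ → ℝ} {L : ι → (ℝ → ℝ) → ℝ}
    (hf : ∀ i ∈ s, HasDistribDeriv k (f i) (L i)) :
    HasDistribDeriv k (fun t => ∑ i ∈ s, f i t) fun φ => ∑ i ∈ s, L i φ := by
  refine ⟨locallyIntegrable_finsetSum s fun i hi => (hf i hi).1, fun φ hφ hs => ?_⟩
  simp only [Finset.sum_mul]
  rw [integral_finsetSum s fun i hi => (hf i hi).integrable_mul hφ hs, Finset.mul_sum]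
  exact Finset.sum_congr rfl fun i hi => (hf i hi).2 φ hφ hs

theorem succ {f' : ℝ → ℝ} (hf : HasDistribDeriv 1 f fun φ => ∫ t, f' t * φ t)
    (hf' : HasDistribDeriv k f' L) : HasDistribDeriv (k + 1) f L := by
  refine ⟨hf.1, fun φ hφ hs => ?_⟩
  have h := hf.2 _ (contDiff_infty_iteratedDeriv hφ k) (hasCompactSupport_iteratedDeriv hs k)
  rw [iteratedDeriv_one, ← iteratedDeriv_succ, pow_one] at h
  rw [pow_succ, mul_assoc, h, hf'.2 φ hφ hs]

theorem of_hasDerivAt {f' : ℝ → ℝ} (hf : ∀ x, HasDerivAt f (f' x) x) (hf' : Continuous f') :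
    HasDistribDeriv 1 f fun φ => ∫ t, f' t * φ t := by
  have hfc : Continuous f := continuous_iff_continuousAt.2 fun x => (hf x).continuousAt
  refine ⟨hfc.locallyIntegrable, fun φ hφ hs => ?_⟩
  rw [iteratedDeriv_one, integral_mul_deriv_eq_deriv_mul_of_integrable (fun x _ => hf x)
    (fun x _ => (hφ.differentiable (by simp) x).hasDerivAt)
    (integrable_mul_of_hasCompactSupport hfc.locallyIntegrable
      (hφ.continuous_deriv (by simp)) hs.deriv)
    (integrable_mul_of_hasCompactSupport hf'.locallyIntegrable hφ.continuous hs)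
    (integrable_mul_of_hasCompactSupport hfc.locallyIntegrable hφ.continuous hs)]
  ring

theorem of_contDiff (hf : ContDiff ℝ k f) :
    HasDistribDeriv k f fun φ => ∫ t, iteratedDeriv k f t * φ t := by
  induction k generalizing f with
  | zero => exact ⟨hf.continuous.locallyIntegrable, fun φ _ _ => by simp⟩
  | succ k ih =>
    rw [Nat.cast_succ] at hf
    obtain ⟨hd, -, hderiv⟩ := contDiff_succ_iff_deriv.1 hf
    rw [iteratedDeriv_succ']
    exact (of_hasDerivAt (fun x => (hd x).hasDerivAt) hderiv.continuous).succ (ih hderiv)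

end HasDistribDeriv

theorem locallyIntegrable_sign_sub (c : ℝ) :
    LocallyIntegrable fun t : ℝ => (SignType.sign (t - c) : ℝ) := by
  refine (locallyIntegrable_const (1 : ℝ)).mono ?_ (Eventually.of_forall fun t => ?_)
  · have hmeas : Measurable fun t : ℝ => deriv (fun x : ℝ => |x|) (t - c) :=
      (measurable_deriv _).comp (measurable_id.sub_const c)
    simpa only [deriv_abs] using hmeas.aestronglyMeasurable
  · rcases lt_trichotomy (t - c) 0 with h | h | h <;> simp [h]

theorem hasDistribDeriv_sign_sub (c : ℝ) :
    HasDistribDeriv 1 (fun t => SignType.sign (t - c)) fun φ => 2 * φ c := by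
  refine ⟨locallyIntegrable_sign_sub c, fun φ hφ hs => ?_⟩
  have hint : Integrable fun t => SignType.sign (t - c) * deriv φ t :=
    integrable_mul_of_hasCompactSupport (locallyIntegrable_sign_sub c)
      (hφ.continuous_deriv (by simp)) hs.deriv
  have hright : ∫ t in Set.Ioi c, SignType.sign (t - c) * deriv φ t = -φ c := by
    rw [← hs.integral_Ioi_deriv_eq (hφ.of_le (by simp)) c]
    refine setIntegral_congr_fun measurableSet_Ioi fun t ht => ?_
    have h : 0 < t - c := sub_pos.2 ht
    simp [h]
  have hleft : ∫ t in Set.Iic c, SignType.sign (t - c) * deriv φ t = -φ c := by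
    rw [← hs.integral_Iic_deriv_eq (hφ.of_le (by simp)) c, ← integral_neg,
      integral_Iic_eq_integral_Iio, integral_Iic_eq_integral_Iio]
    refine setIntegral_congr_fun measurableSet_Iio fun t ht => ?_
    have h : t - c < 0 := sub_neg.2 ht
    simp [h]
  rw [iteratedDeriv_one, ← setIntegral_univ, ← Set.Iic_union_Ioi (a := c),
    setIntegral_union (Set.Iic_disjoint_Ioi le_rfl) measurableSet_Ioi hint.integrableOn
      hint.integrableOn, hleft, hright]
  ring

-- Testing the derivative of `sign` against `(t - c) φ`, which vanishes at `c`, gives that of `|·|`.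
theorem hasDistribDeriv_abs_sub (c : ℝ) :
    HasDistribDeriv 1 (fun t => |t - c|) fun φ => ∫ t, SignType.sign (t - c) * φ t := by
  have habs : Continuous fun t : ℝ => |t - c| := by fun_prop
  refine ⟨habs.locallyIntegrable, fun φ hφ hs => ?_⟩
  have hderiv (t : ℝ) : SignType.sign (t - c) * deriv (fun t => (t - c) * φ t) t =
      SignType.sign (t - c) * φ t + |t - c| * deriv φ t := by
    rw [(((hasDerivAt_id' t).sub_const c).fun_mul
      (hφ.differentiable (by simp) t).hasDerivAt).deriv, one_mul, mul_add, ← mul_assoc,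
      sign_mul_self]
  have h := (hasDistribDeriv_sign_sub c).2 (fun t => (t - c) * φ t)
    ((contDiff_id.sub contDiff_const).mul hφ) hs.mul_left
  simp only [iteratedDeriv_one, hderiv] at h
  rw [integral_add
    (integrable_mul_of_hasCompactSupport (locallyIntegrable_sign_sub c) hφ.continuous hs)
    (integrable_mul_of_hasCompactSupport habs.locallyIntegrable
      (hφ.continuous_deriv (by simp)) hs.deriv), sub_self, zero_mul, mul_zero] at h
  rw [iteratedDeriv_one]
  linarith

theorem hasDistribDeriv_pow_succ_mul_abs {c : ℝ} {j k : ℕ} {L : (ℝ → ℝ) → ℝ}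
    (h : HasDistribDeriv k (fun t => (t - c) ^ j * |t - c|) L) :
    HasDistribDeriv (k + 1) (fun t => (t - c) ^ (j + 1) * |t - c|) fun φ => (j + 2) * L φ :=
  (HasDistribDeriv.of_hasDerivAt
    (fun x => (hasDerivAt_pow_succ_mul_abs j (x - c)).comp_sub_const x c) (by fun_prop)).succ
    (h.const_mul _)

theorem hasDistribDeriv_sq_mul_abs (c : ℝ) :
    HasDistribDeriv 4 (fun t => (t - c) ^ 2 * |t - c|) fun φ => 12 * φ c := by
  have h₀ : HasDistribDeriv 2 (fun t => (t - c) ^ 0 * |t - c|) fun φ => 2 * φ c := by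
    simpa only [pow_zero, one_mul] using
      (hasDistribDeriv_abs_sub c).succ (hasDistribDeriv_sign_sub c)
  refine (hasDistribDeriv_pow_succ_mul_abs (hasDistribDeriv_pow_succ_mul_abs h₀)).congr
    fun φ _ _ => ?_
  push_cast
  ring

theorem hasDistribDeriv_cube_mul_abs (c : ℝ) :
    HasDistribDeriv 4 (fun t => (t - c) ^ 3 * |t - c|)
      fun φ => 24 * ∫ t, SignType.sign (t - c) * φ t := by
  have h₀ : HasDistribDeriv 1 (fun t => (t - c) ^ 0 * |t - c|)
      fun φ => ∫ t, SignType.sign (t - c) * φ t := by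
    simpa only [pow_zero, one_mul] using hasDistribDeriv_abs_sub c
  refine (hasDistribDeriv_pow_succ_mul_abs (hasDistribDeriv_pow_succ_mul_abs
    (hasDistribDeriv_pow_succ_mul_abs h₀))).congr fun φ _ _ => ?_
  push_cast
  ring

end DistributionalDerivative

section CuspSum

theorem iteratedDeriv_four_cuspModel_ae_eq (C D c : ℝ) :
    iteratedDeriv 4 (cuspModel C D c) =ᵐ[volume] fun t => D * (24 * SignType.sign (t - c)) := by
  filter_upwards [Measure.ae_ne volume c] with t ht
  exact iteratedDeriv_four_cuspModel C D ht

theorem locallyIntegrable_iteratedDeriv_four_cuspModel (C D c : ℝ) :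
    LocallyIntegrable (iteratedDeriv 4 (cuspModel C D c)) :=
  (((locallyIntegrable_sign_sub c).smul (24 : ℝ)).smul D).congr
    (iteratedDeriv_four_cuspModel_ae_eq C D c).symm

theorem hasDistribDeriv_cuspModel (C D c : ℝ) :
    HasDistribDeriv 4 (cuspModel C D c) fun φ =>
      (∫ t, iteratedDeriv 4 (cuspModel C D c) t * φ t) + 12 * C * φ c := by
  rw [funext (cuspModel_eq C D c)]
  refine (((hasDistribDeriv_sq_mul_abs c).const_mul C).add
    ((hasDistribDeriv_cube_mul_abs c).const_mul D)).congr fun φ _ _ => ?_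
  rw [← funext (cuspModel_eq C D c), integral_congr_ae
    ((iteratedDeriv_four_cuspModel_ae_eq C D c).mono fun t ht => congrArg (· * φ t) ht)]
  simp only [mul_assoc, integral_const_mul]
  ring

variable {g T : ℝ → ℝ} {S : Finset ℝ} {C D : ℝ → ℝ}

theorem iteratedDeriv_four_add_sum_cuspModel_ae_eq (hg : ContDiff ℝ 4 g) (S : Finset ℝ)
    (C D : ℝ → ℝ) :
    iteratedDeriv 4 (fun t => g t + ∑ c ∈ S, cuspModel (C c) (D c) c t) =ᵐ[volume]
      fun t => iteratedDeriv 4 g t + ∑ c ∈ S, iteratedDeriv 4 (cuspModel (C c) (D c) c) t := by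
  filter_upwards [S.countable_toSet.ae_notMem volume] with t ht
  have hcusp : ∀ c ∈ S, ContDiffAt ℝ (4 : ℕ) (cuspModel (C c) (D c) c) t := fun c hc =>
    contDiffAt_cuspModel _ _ fun h => ht (h ▸ hc)
  rw [iteratedDeriv_fun_add (by exact_mod_cast hg.contDiffAt) (ContDiffAt.sum hcusp),
    iteratedDeriv_fun_sum hcusp]

theorem locallyIntegrable_iteratedDeriv_four_add_sum_cuspModel (hg : ContDiff ℝ 4 g)
    (S : Finset ℝ) (C D : ℝ → ℝ) :
    LocallyIntegrable (iteratedDeriv 4 fun t => g t + ∑ c ∈ S, cuspModel (C c) (D c) c t) :=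
  ((hg.continuous_iteratedDeriv 4 le_rfl).locallyIntegrable.add
    (locallyIntegrable_finsetSum S fun _ _ =>
      locallyIntegrable_iteratedDeriv_four_cuspModel _ _ _)).congr
    (iteratedDeriv_four_add_sum_cuspModel_ae_eq hg S C D).symm

theorem hasDistribDeriv_add_sum_cuspModel (hg : ContDiff ℝ 4 g) (S : Finset ℝ) (C D : ℝ → ℝ) :
    HasDistribDeriv 4 (fun t => g t + ∑ c ∈ S, cuspModel (C c) (D c) c t) fun φ =>
      (∫ t, iteratedDeriv 4 (fun t => g t + ∑ c ∈ S, cuspModel (C c) (D c) c t) t * φ t) +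
        ∑ c ∈ S, 12 * C c * φ c := by
  refine ((HasDistribDeriv.of_contDiff (k := 4) hg).add (HasDistribDeriv.sum fun c _ =>
    hasDistribDeriv_cuspModel (C c) (D c) c)).congr fun φ hφ hs => ?_
  have hcusp : ∀ c ∈ S, Integrable fun t => iteratedDeriv 4 (cuspModel (C c) (D c) c) t * φ t :=
    fun c _ => integrable_mul_of_hasCompactSupport
      (locallyIntegrable_iteratedDeriv_four_cuspModel _ _ _) hφ.continuous hs
  have hsmooth : Integrable fun t => iteratedDeriv 4 g t * φ t :=
    integrable_mul_of_hasCompactSupport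
      (hg.continuous_iteratedDeriv 4 le_rfl).locallyIntegrable hφ.continuous hs
  rw [integral_congr_ae ((iteratedDeriv_four_add_sum_cuspModel_ae_eq hg S C D).mono
    fun t ht => congrArg (· * φ t) ht)]
  simp only [add_mul, Finset.sum_mul]
  rw [integral_add hsmooth (integrable_finsetSum S hcusp), integral_finsetSum S hcusp,
    Finset.sum_add_distrib, add_assoc]

theorem contDiff_sub_sum_cuspModel (hT : ∀ t ∉ S, ContDiffAt ℝ 4 T t)
    (hS : ∀ c ∈ S, ∃ f : ℝ → ℝ, ContDiffAt ℝ 4 f c ∧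
      ∀ᶠ t in 𝓝 c, T t = cuspModel (C c) (D c) c t + f t) :
    ContDiff ℝ 4 fun t => T t - ∑ c ∈ S, cuspModel (C c) (D c) c t := by
  refine contDiff_iff_contDiffAt.2 fun t => ?_
  by_cases ht : t ∈ S
  · obtain ⟨f, hf, hloc⟩ := hS t ht
    have hrest : ContDiffAt ℝ 4 (fun s => f s - ∑ c ∈ S.erase t, cuspModel (C c) (D c) c s) t :=
      hf.sub (ContDiffAt.sum fun c hc =>
        contDiffAt_cuspModel _ _ (Finset.ne_of_mem_erase hc).symm)
    refine hrest.congr_of_eventuallyEq (hloc.mono fun s hs => ?_)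
    beta_reduce
    rw [hs, ← Finset.add_sum_erase S (fun c => cuspModel (C c) (D c) c s) ht,
      add_sub_add_left_eq_sub]
  · exact (hT t ht).sub
      (ContDiffAt.sum fun c hc => contDiffAt_cuspModel _ _ fun h => ht (h ▸ hc))

end CuspSum

section DensityWithAtoms

theorem isLocallyFiniteMeasure_withDensity_ofReal {h : ℝ → ℝ} (hh : LocallyIntegrable h) :
    IsLocallyFiniteMeasure (volume.withDensity fun t => ENNReal.ofReal (h t)) := by
  refine ⟨fun x => ?_⟩
  obtain ⟨U, hU, hi⟩ := hh x
  obtain ⟨V, hVU, hV, hx⟩ := mem_nhds_iff.1 hU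
  refine ⟨V, hV.mem_nhds hx, ?_⟩
  rw [withDensity_apply _ hV.measurableSet]
  exact Integrable.lintegral_lt_top (hi.mono_set hVU)

theorem integral_withDensity_ofReal_of_ae_nonneg {h φ : ℝ → ℝ} (hm : AEMeasurable h)
    (h0 : 0 ≤ᵐ[volume] h) :
    ∫ t, φ t ∂(volume.withDensity fun t => ENNReal.ofReal (h t)) = ∫ t, h t * φ t := by
  rw [integral_withDensity_eq_integral_toReal_smul₀ hm.ennreal_ofReal
    (Eventually.of_forall fun _ => ENNReal.ofReal_lt_top)]
  refine integral_congr_ae ?_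
  filter_upwards [h0] with t ht
  rw [ENNReal.toReal_ofReal ht, smul_eq_mul]

theorem isLocallyFiniteMeasure_add {X : Type*} [TopologicalSpace X] [MeasurableSpace X]
    (μ ν : Measure X) [IsLocallyFiniteMeasure μ] [IsLocallyFiniteMeasure ν] :
    IsLocallyFiniteMeasure (μ + ν) := by
  refine ⟨fun x => ?_⟩
  obtain ⟨U, hU, hμU⟩ := μ.finiteAt_nhds x
  obtain ⟨V, hV, hνV⟩ := ν.finiteAt_nhds x
  refine ⟨U ∩ V, inter_mem hU hV, ?_⟩
  rw [Measure.add_apply]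
  exact ENNReal.add_lt_top.2 ⟨(measure_mono Set.inter_subset_left).trans_lt hμU,
    (measure_mono Set.inter_subset_right).trans_lt hνV⟩

theorem HasDistribDeriv.hasDistribDerivMeasure {k : ℕ} {f h w : ℝ → ℝ} {S : Finset ℝ}
    (hf : HasDistribDeriv k f fun φ => (∫ t, h t * φ t) + ∑ c ∈ S, w c * φ c)
    (hh : LocallyIntegrable h) (hpos : 0 ≤ᵐ[volume] h) (hw : ∀ c ∈ S, 0 ≤ w c) :
    HasDistribDerivMeasure k f (volume.withDensity (fun t => ENNReal.ofReal (h t)) +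
      ∑ c ∈ S, ENNReal.ofReal (w c) • Measure.dirac c) := by
  have hdens := isLocallyFiniteMeasure_withDensity_ofReal hh
  have hatoms : IsFiniteMeasure (∑ c ∈ S, ENNReal.ofReal (w c) • Measure.dirac c) :=
    ⟨by simp [ENNReal.sum_lt_top]⟩
  refine ⟨hf.1, isLocallyFiniteMeasure_add _ _, fun φ hφ hs => ?_⟩
  have hint (μ : Measure ℝ) [IsLocallyFiniteMeasure μ] : Integrable φ μ :=
    hφ.continuous.integrable_of_hasCompactSupport hs
  rw [hf.2 φ hφ hs, integral_add_measure (hint _) (hint _),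
    integral_withDensity_ofReal_of_ae_nonneg hh.aestronglyMeasurable.aemeasurable hpos,
    integral_finsetSum_measure fun c _ => (hint _).smul_measure ENNReal.ofReal_ne_top]
  refine congrArg _ (Finset.sum_congr rfl fun c hc => ?_)
  rw [integral_smul_measure, integral_dirac, ENNReal.toReal_ofReal (hw c hc), smul_eq_mul]

theorem hasDistribDerivMeasure_of_eventuallyEq_cuspModel_add {T : ℝ → ℝ} {S : Finset ℝ}
    {C D : ℝ → ℝ} (hT : ∀ t ∉ S, ContDiffAt ℝ 4 T t)
    (hS : ∀ c ∈ S, ∃ f : ℝ → ℝ, ContDiffAt ℝ 4 f c ∧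
      ∀ᶠ t in 𝓝 c, T t = cuspModel (C c) (D c) c t + f t)
    (hC : ∀ c ∈ S, 0 ≤ C c) (hpos : ∀ t ∉ S, 0 ≤ iteratedDeriv 4 T t) :
    HasDistribDerivMeasure 4 T (volume.withDensity (fun t => ENNReal.ofReal (iteratedDeriv 4 T t)) +
      ∑ c ∈ S, ENNReal.ofReal (12 * C c) • Measure.dirac c) := by
  have hg := contDiff_sub_sum_cuspModel hT hS
  have hderiv := hasDistribDeriv_add_sum_cuspModel hg S C D
  have hint := locallyIntegrable_iteratedDeriv_four_add_sum_cuspModel hg S C D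
  simp only [sub_add_cancel] at hderiv hint
  exact hderiv.hasDistribDerivMeasure hint
    ((S.countable_toSet.ae_notMem volume).mono hpos) fun c hc => mul_nonneg (by simp) (hC c hc)

end DensityWithAtoms

theorem mainTheorem6_general {n : ℕ} {A B : Matrix (Fin n) (Fin n) ℂ}
    (hA : A.IsHermitian) (hB : B.IsHermitian) (hAB : ∃ t : ℝ, IsUnit (A + t • B)) :
    ∃ S : Finset ℝ, (∀ t : ℝ, t ∈ S ↔ ¬ IsUnit (A + t • B)) ∧
      (∀ t : ℝ, t ∉ S → AnalyticAt ℝ (pencilTrace A B) t) ∧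
      (∀ t : ℝ, t ∉ S → 0 ≤ iteratedDeriv 4 (pencilTrace A B) t) ∧
      ∃ C : ℝ → ℝ,
        (∀ c ∈ S, 0 ≤ C c ∧ ∃ (D : ℝ) (f : ℝ → ℝ), ContDiffAt ℝ 4 f c ∧
          ∀ᶠ t in 𝓝 c, pencilTrace A B t =
            C c * |t - c| ^ 3 + D * (|t - c| ^ 3 * (t - c)) + f t) ∧
        HasDistribDerivMeasure 4 (pencilTrace A B)
          (volume.withDensity (fun t => ENNReal.ofReal (iteratedDeriv 4 (pencilTrace A B) t)) +
            ∑ c ∈ S, ENNReal.ofReal (12 * C c) • Measure.dirac c) := by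
  obtain ⟨t₀, ht₀⟩ := hAB
  have hfin := finite_setOf_not_isUnit_add_smul ht₀
  have hunit (t : ℝ) (ht : t ∉ hfin.toFinset) : IsUnit (A + t • B) := by simpa using ht
  have hanalytic := fun t ht => analyticAt_pencilTrace hA hB (hunit t ht)
  have hpos := fun t ht => iteratedDeriv_four_pencilTrace_nonneg hA hB (hunit t ht)
  choose C D hC f hf hcusp using exists_pencilTrace_eventuallyEq_cuspModel_add hA hB
  refine ⟨hfin.toFinset, fun t => by simp, hanalytic, hpos, C,
    fun c _ => ⟨hC c, D c, f c, hf c, hcusp c⟩, ?_⟩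
  exact hasDistribDerivMeasure_of_eventuallyEq_cuspModel_add
    (fun t ht => (hanalytic t ht).contDiffAt) (fun c _ => ⟨f c, hf c, hcusp c⟩)
    (fun c _ => hC c) hpos

theorem mainTheorem6 (n : ℕ) (A B : Matrix (Fin n) (Fin n) ℂ)
    (hA : A.IsHermitian) (hB : B.IsHermitian) (hBinv : IsUnit B) :
    ∃ S : Finset ℝ, (∀ t : ℝ, t ∈ S ↔ ¬ IsUnit (A + t • B)) ∧
      (∀ t : ℝ, t ∉ S → AnalyticAt ℝ (pencilTrace A B) t) ∧
      (∀ t : ℝ, t ∉ S → 0 ≤ iteratedDeriv 4 (pencilTrace A B) t) ∧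
      ∃ C : ℝ → ℝ,
        (∀ c ∈ S, 0 ≤ C c ∧ ∃ (D : ℝ) (f : ℝ → ℝ), ContDiffAt ℝ 4 f c ∧
          ∀ᶠ t in 𝓝 c, pencilTrace A B t =
            C c * |t - c| ^ 3 + D * (|t - c| ^ 3 * (t - c)) + f t) ∧
        HasDistribDerivMeasure 4 (pencilTrace A B)
          (volume.withDensity (fun t => ENNReal.ofReal (iteratedDeriv 4 (pencilTrace A B) t)) +
            ∑ c ∈ S, ENNReal.ofReal (12 * C c) • Measure.dirac c) :=
  mainTheorem6_general hA hB (exists_isUnit_add_smul A hBinv)
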